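/- Let $\mathbb W$ be the wrapped dyadic lattice graph: its vertices are all finite binary strings, including the empty string $\varnothing$; each string $w$ of length (depth) $n$ is joined to $w+1$ and $w-1$ (addition modulo $2^n$, strings being read as integers in binary) and to $w0$ ($w$ with a $0$ appended), and, if $w$ ends in $0$, also to the string obtained by deleting this final $0$. Edges are counted with multiplicity, and at $\varnothing$ the two horizontal edges are loops, each counted once. Let $\mathbb W^\dagger$ be the wrapped dual graph on the same vertex set, in which $w$ is joined to $w+1$, $w-1$, $w0$, $w1$ and, if $w\neq\varnothing$, to $w$ with its final bit deleted (same conventions). The horizontal position of a string $w$ of length $n$ that represents the integer $k\in\{0,\dots,2^n-1\}$ is $k/2^n$, viewed as a point of $\mathbb R/\mathbb Z$. Let $(X_t)_{t\ge 0}$ be simple random walk on $\mathbb W$ (respectively on $\mathbb W^\dagger$) started at $\varnothing$. In both cases the horizontal positions of $X_t$ converge almost surely in $\mathbb R/\mathbb Z$. Identifying $\mathbb R/\mathbb Z$ with $[0,1)$, let the harmonic measure $\nu_{\mathrm h}$ (respectively the dual harmonic measure $\nu_{\mathrm h}^\dagger$) be the law of the limit; it is a probability measure carried by $[0,1)$.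 Then: 1. $\nu_{\mathrm h}$ and $\nu_{\mathrm h}^\dagger$ are mutually singular. 2. $\nu_{\mathrm h}^\dagger$ is Lebesgue measure on $[0,1)$; consequently $\nu_{\mathrm h}$ is singular with respect to Lebesgue measure on $[0,1)$, and in particular distinct from it. 3. Let $\sigma(x)=2x \bmod 1$ be the left shift of binary digits. Then $(\sigma,\nu_{\mathrm h})$ is a factor of an i.i.d. sequence: there are a standard Borel probability space $(S,p)$ and a measurable $F\colon S^{\mathbb N}\to\mathbb R$ with $F_*(p^{\otimes\mathbb N})=\nu_{\mathrm h}$ and $F(s_1,s_2,\dots)=\sigma(F(s_0,s_1,\dots))$ for $p^{\otimes\mathbb N}$-almost every $s$. Moreover $\nu_{\mathrm h}$ is $\sigma$-invariant and ergodic. -/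

import Mathlib

open MeasureTheory ProbabilityTheory Filter Topology

/-- Finite binary strings, stored with the last (rightmost, units) digit at the head of the list.
Thus `false :: w` is the string `w` with a `0` appended on the right, `true :: w` is `w` with a `1`
appended on the right, and the tail of `w` is `w` with its final bit removed. The length of a
string is its depth. -/
abbrev BitString : Type := List Bool

/-- The set of finite binary strings is a discrete countable space. -/
instance BitString.instMeasurableSpace : MeasurableSpace BitString := ⊤

instance BitString.instDiscreteMeasurableSpace : DiscreteMeasurableSpace BitString :=
  ⟨fun _ => trivial⟩

namespace BitString

/-- Adding `1` to a string of length `n`, modulo `2 ^ n` (binary addition with carry, in which the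
carry out of the leading digit is dropped). The empty string is sent to itself. -/
def succ : BitString → BitString
  | [] => []
  | false :: w => true :: w
  | true :: w => false :: succ w

/-- Subtracting `1` from a string of length `n`, modulo `2 ^ n`. The empty string is sent to
itself. -/
def pred : BitString → BitString
  | [] => []
  | true :: w => false :: w
  | false :: w => true :: pred w

/-- The integer in `[0, 2 ^ n)` whose binary expansion is the given string of length `n`. -/
def val : BitString → ℕ
  | [] => 0
  | b :: w => 2 * val w + b.toNat

theorem length_succ (w : BitString) : (succ w).length = w.length := by
  induction w with
  | nil => rfl
  | cons b w ih => cases b <;> simp [succ, ih]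

theorem val_lt (w : BitString) : val w < 2 ^ w.length := by
  induction w with
  | nil => simp [val]
  | cons b w ih =>
    have := Bool.toNat_le b
    simp only [val, List.length_cons, pow_succ]
    omega

/-- `succ` is addition of `1` modulo `2 ^ n`. -/
theorem val_succ (w : BitString) : val (succ w) = (val w + 1) % 2 ^ w.length := by
  induction w with
  | nil => simp [succ, val]
  | cons b w ih =>
    have hw := val_lt w
    cases b
    · simp only [succ, val, List.length_cons, pow_succ, Bool.toNat_true, Bool.toNat_false]
      rw [Nat.mod_eq_of_lt] <;> omega
    · simp only [succ, val, ih, List.length_cons, pow_succ, Bool.toNat_true, Bool.toNat_false]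
      rw [show 2 * val w + 1 + 1 = 2 * (val w + 1) by ring, mul_comm (2 ^ _) 2,
        Nat.mul_mod_mul_left]
      rfl

theorem succ_pred (w : BitString) : succ (pred w) = w := by
  induction w with
  | nil => rfl
  | cons b w ih => cases b <;> simp [succ, pred, ih]

theorem pred_succ (w : BitString) : pred (succ w) = w := by
  induction w with
  | nil => rfl
  | cons b w ih => cases b <;> simp [succ, pred, ih]

/-- The horizontal position of a string `w` of length `n`: the number `val w / 2 ^ n ∈ [0, 1)`,
that is, the number with binary expansion `0.w`. -/
noncomputable def position (w : BitString) : ℝ := (val w : ℝ) / 2 ^ w.length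

end BitString

/-- The wrapped dyadic lattice graph: the neighbours of each vertex, listed with multiplicity. Every
string `w` is joined to `w + 1`, to `w - 1` and to `w` with a `0` appended; if moreover `w` ends
in `0`, it is joined to the string obtained by removing this `0`. At the empty string the two
horizontal edges are loops, each of which counts once. -/
def primalNeighbors : BitString → Multiset BitString
  | [] => {[], [], [false]}
  | true :: w => {BitString.succ (true :: w), BitString.pred (true :: w), false :: true :: w}
  | false :: w =>
      {BitString.succ (false :: w), BitString.pred (false :: w), false :: false :: w, w}

/-- The wrapped dual dyadic lattice graph: the neighbours of each vertex, listed with multiplicity.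
A face is labelled by the string of the vertex in its upper left corner. The face `w` is joined to
the faces `w + 1`, `w - 1`, `w` with a `0` appended, `w` with a `1` appended and, if `w` is
nonempty, `w` with its final bit removed. -/
def dualNeighbors : BitString → Multiset BitString
  | [] => {[], [], [false], [true]}
  | b :: w =>
      {BitString.succ (b :: w), BitString.pred (b :: w), false :: b :: w, true :: b :: w, w}

theorem primalNeighbors_ne_zero (w : BitString) : primalNeighbors w ≠ 0 := by
  rcases w with _ | ⟨_ | _, w⟩ <;> simp [primalNeighbors]

theorem dualNeighbors_ne_zero (w : BitString) : dualNeighbors w ≠ 0 := by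
  rcases w with _ | ⟨b, w⟩ <;> simp [dualNeighbors]

/-- The transition kernel of simple random walk on a graph on binary strings that is given by its
(nonempty) multisets of neighbours: from `w`, the walk moves to a uniformly random element of
`nbrs w`, counted with multiplicity. -/
noncomputable def srwKernel (nbrs : BitString → Multiset BitString) (h : ∀ w, nbrs w ≠ 0) :
    Kernel BitString BitString :=
  Kernel.ofFunOfCountable fun w => (PMF.ofMultiset (nbrs w) (h w)).toMeasure

instance srwKernel.instIsMarkovKernel (nbrs : BitString → Multiset BitString)
    (h : ∀ w, nbrs w ≠ 0) : IsMarkovKernel (srwKernel nbrs h) :=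
  ⟨fun w => by
    change IsProbabilityMeasure (PMF.ofMultiset (nbrs w) (h w)).toMeasure
    infer_instance⟩

/-- The transition kernel seen as a kernel from trajectories up to time `n` to the state at time
`n + 1`; it depends only on the state at time `n`. -/
noncomputable def srwHistoryKernel (nbrs : BitString → Multiset BitString)
    (h : ∀ w, nbrs w ≠ 0) (n : ℕ) :
    Kernel ((i : Finset.Iic n) → (fun _ : ℕ => BitString) i) BitString :=
  (srwKernel nbrs h).comap (fun x => x ⟨n, Finset.mem_Iic.2 le_rfl⟩) (measurable_pi_apply _)

instance srwHistoryKernel.instIsMarkovKernel (nbrs : BitString → Multiset BitString)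
    (h : ∀ w, nbrs w ≠ 0) (n : ℕ) : IsMarkovKernel (srwHistoryKernel nbrs h n) := by
  unfold srwHistoryKernel
  infer_instance

/-- The law, on the space of trajectories, of simple random walk `(X_t)_{t ≥ 0}` started from the
empty string. -/
noncomputable def srwLaw (nbrs : BitString → Multiset BitString) (h : ∀ w, nbrs w ≠ 0) :
    Measure (ℕ → BitString) :=
  Kernel.traj (X := fun _ : ℕ => BitString) (srwHistoryKernel nbrs h) 0 (fun _ => [])

/-- The law of simple random walk on the wrapped dyadic lattice graph, from the empty string. -/
noncomputable def primalWalk : Measure (ℕ → BitString) :=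
  srwLaw primalNeighbors primalNeighbors_ne_zero

/-- The law of simple random walk on the wrapped dual graph, from the empty string. -/
noncomputable def dualWalk : Measure (ℕ → BitString) :=
  srwLaw dualNeighbors dualNeighbors_ne_zero

/-- The horizontal position of a vertex, as a point of the circle `ℝ / ℤ`. -/
noncomputable def circlePosition (w : BitString) : UnitAddCircle := (BitString.position w : ℝ)

/-- The limit in `ℝ / ℤ` of the horizontal positions along a trajectory, represented by the
corresponding number in `[0, 1)`. (Meaningful when the positions converge.) -/
noncomputable def limitPosition (X : ℕ → BitString) : ℝ :=
  (AddCircle.equivIco (1 : ℝ) 0 (limUnder atTop fun t => circlePosition (X t)) : ℝ)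

/-- The harmonic measure of simple random walk on the wrapped dyadic lattice graph: the law of the
limit in `[0, 1)` of the horizontal positions of the walk. -/
noncomputable def harmonicMeasure : Measure ℝ := primalWalk.map limitPosition

/-- The harmonic measure of simple random walk on the wrapped dual graph. -/
noncomputable def dualHarmonicMeasure : Measure ℝ := dualWalk.map limitPosition

/-- The left shift of binary digits on `[0, 1)`, that is, `x ↦ 2 x mod 1`. -/
noncomputable def digitShift (x : ℝ) : ℝ := Int.fract (2 * x)

/-- The system `(T, μ)` on the real line is a (one-sided) factor of an i.i.d. sequence: `μ` is the
image of a product measure `p^{⊗ℕ}` under a measurable map `F` that intertwines, almost surely, the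
left shift of sequences with `T`. -/
def IsFactorOfIID (T : ℝ → ℝ) (μ : Measure ℝ) : Prop :=
  ∃ (S : Type) (_ : MeasurableSpace S) (_ : StandardBorelSpace S) (p : Measure S)
    (_ : IsProbabilityMeasure p) (F : (ℕ → S) → ℝ),
    Measurable F ∧
    (∀ᵐ s ∂(Measure.infinitePi fun _ : ℕ => p), F (fun n => s (n + 1)) = T (F s)) ∧
    (Measure.infinitePi fun _ : ℕ => p).map F = μ

/-! Everything is read off Fourier coefficients. For both walks a weight comparable to `(3/4) ^
depth` decreases geometrically in mean, while a step moves the position by at most `2 ^ (-depth)`.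
So the positions are almost surely Cauchy, and the Fourier coefficients of the harmonic measures are
limits of expectations along the walk.

Dual walk: all vertices of one level have the same degree and the same numbers of parents and
children, so averaging preserves the functions with zero sum on every level. A nontrivial character
sums to zero on all deep levels, hence its coefficient vanishes and the limit law is Lebesgue
measure.

Primal walk: below the root the wrapped graph unrolls to a half lattice of sites `(x, j)`, with the
walk killed when it moves up from level zero. Let A(θ) = `escapeChar θ` be the expectation of
exp(iθY) over the walks from the origin that are never killed, with Y the limit position. Splitting
at the last visit to the root gives the coefficients A(πk)/A(0). Splitting at the last exit from
level zero, with self-similarity, gives A(θ) = A(θ/2) B(θ) (`escapeChar_eq_mul`), where B =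
`exitChar` is the characteristic function of an integer law with a first moment. Iterating,
A(θ)/A(0) is the product of the B(θ/2^n). So the harmonic measure is the law of ∑ s_n / 2^(n+1) mod
1 with i.i.d. integers s_n. Doubling drops s_0, which exhibits a factor of a Bernoulli shift, hence
ergodicity.

Lebesgue measure is ergodic for doubling too, and distinct ergodic probability measures are mutually
singular. It remains to see that the two differ, and for this A(π) ≠ 0 is enough; it holds because B
has no zeros (`exitChar_ne_zero`).

The walk on the half lattice is never constructed: A and B are values of solutions of linear
equations, built by Neumann series and identified by uniqueness in a weighted sup norm
(`killedStep_contracts`). -/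

/-! ### Neumann series for weighted contractions -/

section Neumann

variable {α : Type*}

/-- A linear operator contracts the sup norm with weight `V` by the factor `r`. -/
def ContractsWeight (V : α → ℝ) (r : ℝ) (T : (α → ℂ) →ₗ[ℂ] (α → ℂ)) : Prop :=
  ∀ (f : α → ℂ) (C : ℝ), (∀ s, ‖f s‖ ≤ C * V s) → ∀ s, ‖T f s‖ ≤ C * r * V s

/-- The Neumann series `∑ T ^ t c`. -/
noncomputable def neumann (T : (α → ℂ) →ₗ[ℂ] (α → ℂ)) (c : α → ℂ) (s : α) : ℂ :=
  ∑' t : ℕ, (T ^ t) c s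

variable {V : α → ℝ} {r : ℝ} {T : (α → ℂ) →ₗ[ℂ] (α → ℂ)}

theorem ContractsWeight.norm_pow_apply_le (hT : ContractsWeight V r T) {c : α → ℂ} {C : ℝ}
    (hc : ∀ s, ‖c s‖ ≤ C * V s) (t : ℕ) (s : α) : ‖(T ^ t) c s‖ ≤ C * r ^ t * V s := by
  induction t generalizing s with
  | zero => simpa using hc s
  | succ t ih =>
    rw [pow_succ', Module.End.mul_apply]
    calc _ ≤ _ := hT _ _ ih s
      _ = _ := by ring

/-- Stated for a single function instead of an operator because `exitChar_ne_zero` needs it for an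
equation that is not the one of `killedStep`. -/
theorem eq_zero_of_contraction {f : α → ℂ} (hr0 : 0 ≤ r) (hr : r < 1) {C : ℝ}
    (hf : ∀ s, ‖f s‖ ≤ C * V s)
    (h : ∀ C, (∀ s, ‖f s‖ ≤ C * V s) → ∀ s, ‖f s‖ ≤ C * r * V s) : f = 0 := by
  have key : ∀ n : ℕ, ∀ s, ‖f s‖ ≤ C * r ^ n * V s := by
    intro n
    induction n with
    | zero => simpa using hf
    | succ n ih =>
      intro s
      calc _ ≤ _ := h _ ih s
        _ = _ := by ring
  funext s
  have lim : Tendsto (fun n : ℕ => C * r ^ n * V s) atTop (𝓝 (C * 0 * V s)) :=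
    ((tendsto_pow_atTop_nhds_zero_of_lt_one hr0 hr).const_mul C).mul_const (V s)
  have := ge_of_tendsto' lim fun n => key n s
  simpa using this

theorem ContractsWeight.eq_zero (hT : ContractsWeight V r T) (hr0 : 0 ≤ r) (hr : r < 1)
    {f : α → ℂ} {C : ℝ} (hf : ∀ s, ‖f s‖ ≤ C * V s) (h : T f = f) : f = 0 :=
  eq_zero_of_contraction hr0 hr hf fun C hC => by
    have := hT f C hC
    rwa [h] at this

theorem ContractsWeight.summable (hT : ContractsWeight V r T) (hr0 : 0 ≤ r) (hr : r < 1)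
    {c : α → ℂ} {C : ℝ} (hc : ∀ s, ‖c s‖ ≤ C * V s) (s : α) :
    Summable fun t : ℕ => (T ^ t) c s :=
  Summable.of_norm_bounded
    (((summable_geometric_of_lt_one hr0 hr).mul_left C).mul_right (V s))
    fun t => hT.norm_pow_apply_le hc t s

theorem ContractsWeight.norm_neumann_le (hT : ContractsWeight V r T) (hr0 : 0 ≤ r) (hr : r < 1)
    {c : α → ℂ} {C : ℝ} (hc : ∀ s, ‖c s‖ ≤ C * V s) (s : α) :
    ‖neumann T c s‖ ≤ C * (1 - r)⁻¹ * V s := by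
  refine tsum_of_norm_bounded ?_ fun t => hT.norm_pow_apply_le hc t s
  exact ((hasSum_geometric_of_lt_one hr0 hr).mul_left C).mul_right (V s)

theorem ContractsWeight.neumann_eq_sum_add (hT : ContractsWeight V r T) (hr0 : 0 ≤ r)
    (hr : r < 1) {c : α → ℂ} {C : ℝ} (hc : ∀ s, ‖c s‖ ≤ C * V s) (n : ℕ) :
    neumann T c = ∑ t ∈ Finset.range n, (T ^ t) c + neumann T ((T ^ n) c) := by
  funext s
  rw [Pi.add_apply, Finset.sum_apply]
  simp only [neumann]
  rw [← (hT.summable hr0 hr hc s).sum_add_tsum_nat_add n]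
  simp only [pow_add, Module.End.mul_apply]

/-- No continuity of `T` is available for moving it through the infinite sum. Instead `n` terms are
split off: the finite part telescopes, and the tail is geometrically small both before and after
applying `T`. -/
theorem ContractsWeight.map_neumann (hT : ContractsWeight V r T) (hr0 : 0 ≤ r)
    (hr : r < 1) {c : α → ℂ} {C : ℝ} (hc : ∀ s, ‖c s‖ ≤ C * V s) :
    T (neumann T c) = neumann T c - c := by
  have hC := hT.norm_pow_apply_le hc
  have tail n := fun s => hT.norm_neumann_le hr0 hr (hC n) s
  have id1 (n : ℕ) : T (neumann T c) - (neumann T c - c)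
      = T (neumann T ((T ^ n) c)) - neumann T ((T ^ (n + 1)) c) := by
    have e1 := congrArg T (hT.neumann_eq_sum_add hr0 hr hc n)
    have e2 := hT.neumann_eq_sum_add hr0 hr hc (n + 1)
    rw [map_add, map_sum] at e1
    rw [Finset.sum_range_succ'] at e2
    simp only [pow_succ', Module.End.mul_apply, pow_zero, Module.End.one_apply] at e1 e2 ⊢
    rw [e1, e2]
    abel
  rw [← sub_eq_zero]
  funext s
  have bound (n : ℕ) : ‖(T (neumann T c) - (neumann T c - c)) s‖
      ≤ C * (1 - r)⁻¹ * r * V s * r ^ n * 2 := by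
    rw [id1 n]
    have h1 := hT _ _ (tail n) s
    have h2 := tail (n + 1) s
    calc _ ≤ _ := norm_sub_le _ _
      _ ≤ _ := add_le_add h1 h2
      _ = _ := by ring
  have lim := ((tendsto_pow_atTop_nhds_zero_of_lt_one hr0 hr).const_mul
    (C * (1 - r)⁻¹ * r * V s)).mul_const 2
  have := ge_of_tendsto' lim bound
  simpa using this

theorem ContractsWeight.eq_neumann (hT : ContractsWeight V r T) (hr0 : 0 ≤ r)
    (hr : r < 1) {c g : α → ℂ} {C C' : ℝ} (hc : ∀ s, ‖c s‖ ≤ C * V s)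
    (hg : ∀ s, ‖g s‖ ≤ C' * V s) (h : T g = g - c) : g = neumann T c := by
  rw [← sub_eq_zero]
  refine hT.eq_zero hr0 hr (C := C' + C * (1 - r)⁻¹) (fun s => ?_) ?_
  · have := hT.norm_neumann_le hr0 hr hc s
    calc _ ≤ _ := norm_sub_le _ _
      _ ≤ _ := add_le_add (hg s) this
      _ = _ := by ring
  · rw [map_sub, h, hT.map_neumann hr0 hr hc]
    abel

end Neumann

/-! ### The killed walk on the half lattice and its Lyapunov weight -/

section HalfLattice

/-- The value of `f` at the parent of a site `(x, j)` of the half lattice, and zero if there is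
none. The site `(x, j)` has horizontal position `x / 2 ^ j`. -/
def latticeUp (f : ℤ × ℕ → ℂ) : ℤ × ℕ → ℂ
  | (_, 0) => 0
  | (x, j + 1) => if Even x then f (x / 2, j) else 0

/-- The sum of `f` over the neighbours in the half lattice. -/
def latticeSum (f : ℤ × ℕ → ℂ) (s : ℤ × ℕ) : ℂ :=
  f (s.1 + 1, s.2) + f (s.1 - 1, s.2) + f (2 * s.1, s.2 + 1) + latticeUp f s

/-- The degree of a site in the dyadic lattice. -/
def latticeDeg (x : ℤ) : ℝ := if Even x then 4 else 3

/-- The averaging operator of simple random walk on the half lattice, killed when it moves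
up from level zero. -/
noncomputable def killedStep : (ℤ × ℕ → ℂ) →ₗ[ℂ] (ℤ × ℕ → ℂ) where
  toFun f s := latticeSum f s / latticeDeg s.1
  map_add' f g := by
    funext ⟨x, j⟩
    rcases j with _ | j <;> simp only [latticeSum, latticeUp, Pi.add_apply]
    · ring
    · split_ifs <;> ring
  map_smul' a f := by
    funext ⟨x, j⟩
    rcases j with _ | j <;>
      simp only [latticeSum, latticeUp, Pi.smul_apply, smul_eq_mul, RingHom.id_apply]
    · ring
    · split_ifs <;> ring

theorem killedStep_apply (f : ℤ × ℕ → ℂ) (s : ℤ × ℕ) :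
    killedStep f s = latticeSum f s / latticeDeg s.1 := rfl

/-- A Lyapunov weight on the half lattice. -/
noncomputable def latticeWeight (s : ℤ × ℕ) : ℝ :=
  (3 / 4) ^ s.2 * (if Even s.1 then 1 else 15 / 16) * (96 + |(s.1 : ℝ)| / 2 ^ s.2)

theorem latticeWeight_le (s : ℤ × ℕ) :
    latticeWeight s ≤ (3 / 4) ^ s.2 * (96 + |(s.1 : ℝ)| / 2 ^ s.2) := by
  unfold latticeWeight
  gcongr
  split_ifs <;> norm_num

theorem le_latticeWeight (s : ℤ × ℕ) :
    (3 / 4) ^ s.2 * (15 / 16) * (96 + |(s.1 : ℝ)| / 2 ^ s.2) ≤ latticeWeight s := by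
  unfold latticeWeight
  gcongr
  split_ifs <;> norm_num

theorem latticeWeight_pos (s : ℤ × ℕ) : 0 < latticeWeight s :=
  lt_of_lt_of_le (by positivity) (le_latticeWeight s)

theorem abs_add_one_div_le (x : ℤ) (j : ℕ) (e : ℤ) (he : |(e : ℝ)| ≤ 1) :
    |((x + e : ℤ) : ℝ)| / 2 ^ j ≤ |(x : ℝ)| / 2 ^ j + 1 := by
  have h1 : |((x + e : ℤ) : ℝ)| ≤ |(x : ℝ)| + 1 := by
    push_cast
    exact (abs_add_le _ _).trans (by linarith)
  have h2 : (1 : ℝ) / 2 ^ j ≤ 1 := by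
    rw [div_le_one (by positivity)]
    exact one_le_pow₀ (by norm_num)
  calc _ ≤ (|(x : ℝ)| + 1) / 2 ^ j := by gcongr
    _ = |(x : ℝ)| / 2 ^ j + 1 / 2 ^ j := by ring
    _ ≤ _ := by linarith

theorem latticeWeight_down (x : ℤ) (j : ℕ) :
    latticeWeight (2 * x, j + 1) = 3 / 4 * ((3 / 4) ^ j * (96 + |(x : ℝ)| / 2 ^ j)) := by
  have : (2 * |(x : ℝ)|) / 2 ^ (j + 1) = |(x : ℝ)| / 2 ^ j := by
    rw [pow_succ]
    field_simp
  simp only [latticeWeight, even_two_mul, if_true]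
  push_cast
  rw [abs_mul, abs_two, this]
  ring

theorem nonneg_of_norm_le {f : ℤ × ℕ → ℂ} {C : ℝ} (hf : ∀ s, ‖f s‖ ≤ C * latticeWeight s) :
    0 ≤ C :=
  nonneg_of_mul_nonneg_left ((norm_nonneg _).trans (hf (0, 0))) (latticeWeight_pos _)

theorem norm_latticeUp_le {f : ℤ × ℕ → ℂ} {C : ℝ} (hf : ∀ s, ‖f s‖ ≤ C * latticeWeight s)
    (s : ℤ × ℕ) :
    ‖latticeUp f s‖ ≤ C * (if s.2 ≠ 0 ∧ Even s.1 then 4 / 3 * latticeWeight s else 0) := by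
  obtain ⟨x, j⟩ := s
  have hC := nonneg_of_norm_le hf
  rcases j with _ | j
  · simp [latticeUp]
  by_cases hx : Even x
  · obtain ⟨m, rfl⟩ := hx.exists_two_nsmul
    have h1 := hf (m, j)
    have h2 := mul_le_mul_of_nonneg_left (latticeWeight_le (m, j)) hC
    simp only [nsmul_eq_mul, Nat.cast_ofNat] at *
    simp only [latticeUp, even_two_mul, if_true, ne_eq, Nat.succ_ne_zero, not_false_eq_true,
      and_self, latticeWeight_down]
    rw [Int.mul_ediv_cancel_left _ two_ne_zero]
    calc _ ≤ _ := h1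
      _ ≤ _ := h2
      _ = _ := by ring
  · simp [latticeUp, hx]

/-- At an even site below level zero the neighbours have relative weights `15/16 + 15/16 + 3/4 + 4/3
= 4 * (95/96)`; without the factor `15/16` on odd sites the sum would exceed `4`. At an odd site `1
+ 1 + 3/4` stays below `3 * (15/16)`. The offset `96` absorbs the change of `|x| / 2 ^ j` in a
horizontal step, and the rate weakens to `191/192`. At level zero the factor is `3` even for even
sites. Killing alone would need only `4`; the sharper form serves `exitChar_ne_zero`. -/
theorem norm_latticeSum_le {f : ℤ × ℕ → ℂ} {C : ℝ} (hf : ∀ s, ‖f s‖ ≤ C * latticeWeight s)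
    (s : ℤ × ℕ) :
    ‖latticeSum f s‖ ≤ C * (191 / 192) * latticeWeight s *
      (if s.2 ≠ 0 ∧ Even s.1 then 4 else 3) := by
  obtain ⟨x, j⟩ := s
  have hC := nonneg_of_norm_le hf
  have hup := norm_latticeUp_le hf (x, j)
  have h1 := hf (x + 1, j)
  have h2 := hf (x - 1, j)
  have h3 := hf (2 * x, j + 1)
  rw [latticeWeight_down] at h3
  have a1 := abs_add_one_div_le x j 1 (by simp)
  have a2 := abs_add_one_div_le x j (-1) (by simp)
  rw [← sub_eq_add_neg] at a2
  have hn : ‖latticeSum f (x, j)‖ ≤ ‖f (x + 1, j)‖ + ‖f (x - 1, j)‖ + ‖f (2 * x, j + 1)‖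
      + ‖latticeUp f (x, j)‖ :=
    (norm_add_le _ _).trans (by gcongr; exact norm_add₃_le)
  refine hn.trans ((add_le_add (add_le_add (add_le_add h1 h2) h3) hup).trans ?_)
  rw [← mul_add, ← mul_add, ← mul_add, mul_assoc, mul_assoc]
  refine mul_le_mul_of_nonneg_left ?_ hC
  have hy : 0 ≤ |(x : ℝ)| / 2 ^ j := by positivity
  have hq : (0 : ℝ) < (3 / 4) ^ j := by positivity
  simp only [latticeWeight]
  generalize |(x : ℝ)| / 2 ^ j = y at *
  generalize |((x + 1 : ℤ) : ℝ)| / 2 ^ j = y1 at *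
  generalize |((x - 1 : ℤ) : ℝ)| / 2 ^ j = y2 at *
  generalize ((3 / 4) ^ j : ℝ) = q at *
  by_cases hx : Even x
  · have e1 : ¬ Even (x + 1) := by simpa [Int.even_add_one] using hx
    have e2 : ¬ Even (x - 1) := by simpa [Int.even_sub_one] using hx
    simp only [hx, e1, e2, if_true, if_false, and_true]
    have : q * (15 / 16 * (96 + y1) + 15 / 16 * (96 + y2) + 3 / 4 * (96 + y) +
        if j ≠ 0 then 4 / 3 * (96 + y) else 0) ≤
        q * (191 / 192 * (96 + y) * if j ≠ 0 then 4 else 3) := by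
      refine mul_le_mul_of_nonneg_left ?_ hq.le
      split_ifs <;> linarith
    split_ifs at this ⊢ <;> linarith
  · have e1 : Even (x + 1) := by simpa [Int.even_add_one] using hx
    have e2 : Even (x - 1) := by simpa [Int.even_sub_one] using hx
    simp only [hx, e1, e2, if_true, if_false, and_false]
    have : q * ((96 + y1) + (96 + y2) + 3 / 4 * (96 + y)) ≤
        q * (191 / 192 * (15 / 16 * (96 + y)) * 3) := by
      refine mul_le_mul_of_nonneg_left ?_ hq.le
      linarith
    linarith

theorem latticeDeg_pos (x : ℤ) : 0 < latticeDeg x := by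
  unfold latticeDeg
  split_ifs <;> norm_num

theorem three_le_latticeDeg (x : ℤ) : 3 ≤ latticeDeg x := by
  unfold latticeDeg
  split_ifs <;> norm_num

theorem killedStep_contracts : ContractsWeight latticeWeight (191 / 192) killedStep := by
  intro f C hf s
  have hC := nonneg_of_norm_le hf
  have hV := latticeWeight_pos s
  rw [killedStep_apply, norm_div, Complex.norm_real, Real.norm_of_nonneg (latticeDeg_pos _).le,
    div_le_iff₀ (latticeDeg_pos _)]
  refine (norm_latticeSum_le hf s).trans ?_
  gcongr
  unfold latticeDeg
  split_ifs <;> grind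

/-- The horizontal translation of the half lattice by `b` steps of level zero. -/
def latticeShift (b : ℤ) (f : ℤ × ℕ → ℂ) (s : ℤ × ℕ) : ℂ := f (s.1 + 2 ^ s.2 * b, s.2)

theorem latticeSum_latticeShift (b : ℤ) (f : ℤ × ℕ → ℂ) (s : ℤ × ℕ) :
    latticeSum (latticeShift b f) s = latticeSum f (s.1 + 2 ^ s.2 * b, s.2) := by
  obtain ⟨x, j⟩ := s
  have h1 : x + 1 + 2 ^ j * b = x + 2 ^ j * b + 1 := by ring
  have h2 : x - 1 + 2 ^ j * b = x + 2 ^ j * b - 1 := by ring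
  have h3 : 2 * x + 2 ^ (j + 1) * b = 2 * (x + 2 ^ j * b) := by ring
  have h4 : latticeUp (latticeShift b f) (x, j) = latticeUp f (x + 2 ^ j * b, j) := by
    rcases j with _ | j
    · rfl
    · have e1 : x + 2 ^ (j + 1) * b = x + 2 * (2 ^ j * b) := by ring
      simp only [latticeUp, latticeShift]
      rw [e1, Int.add_mul_ediv_left _ _ two_ne_zero]
      simp [Int.even_add]
  simp only [latticeSum, h4]
  simp only [latticeShift, h1, h2, h3]

theorem latticeWeight_shift_le (b : ℤ) (s : ℤ × ℕ) :
    latticeWeight (s.1 + 2 ^ s.2 * b, s.2) ≤ 2 * (1 + |(b : ℝ)|) * latticeWeight s := by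
  obtain ⟨x, j⟩ := s
  have h : |((x + 2 ^ j * b : ℤ) : ℝ)| / 2 ^ j ≤ |(x : ℝ)| / 2 ^ j + |(b : ℝ)| := by
    push_cast
    calc _ ≤ (|(x : ℝ)| + |2 ^ j * (b : ℝ)|) / 2 ^ j := by gcongr; exact abs_add_le _ _
      _ = _ := by
        rw [abs_mul, abs_of_pos (by positivity : (0 : ℝ) < 2 ^ j)]
        field_simp
  refine (latticeWeight_le _).trans ((?_ : _ ≤ _).trans
    (mul_le_mul_of_nonneg_left (le_latticeWeight (x, j)) (by positivity)))
  simp only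
  have hy : 0 ≤ |(x : ℝ)| / 2 ^ j := by positivity
  have hb : 0 ≤ |(b : ℝ)| := by positivity
  rw [show 2 * (1 + |(b : ℝ)|) * ((3 / 4) ^ j * (15 / 16) * (96 + |(x : ℝ)| / 2 ^ j)) =
    (3 / 4) ^ j * (15 / 8 * (1 + |(b : ℝ)|) * (96 + |(x : ℝ)| / 2 ^ j)) by ring]
  refine mul_le_mul_of_nonneg_left ?_ (by positivity)
  nlinarith [mul_nonneg hy hb]

end HalfLattice

/-! ### Escape functions with prescribed boundary values -/

section Waves

theorem norm_exp_mul_I_sub_le (a b : ℝ) :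
    ‖Complex.exp (a * Complex.I) - Complex.exp (b * Complex.I)‖ ≤ |a - b| := by
  have h : Complex.exp (a * Complex.I) - Complex.exp (b * Complex.I)
      = Complex.exp (b * Complex.I) * (Complex.exp (Complex.I * (a - b : ℝ)) - 1) := by
    rw [mul_sub, ← Complex.exp_add, mul_one]
    congr 2
    push_cast
    ring
  rw [h, norm_mul, Complex.norm_exp_ofReal_mul_I, one_mul]
  exact Real.norm_exp_I_mul_ofReal_sub_one_le

theorem three_quarters_pow_le_latticeWeight (s : ℤ × ℕ) : 2 * (3 / 4) ^ s.2 ≤ latticeWeight s := by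
  refine le_trans ?_ (le_latticeWeight s)
  have h : (0 : ℝ) < (3 / 4) ^ s.2 := by positivity
  have hy : 0 ≤ |(s.1 : ℝ)| / 2 ^ s.2 := by positivity
  nlinarith [mul_nonneg h.le hy]

theorem one_div_two_pow_le_latticeWeight (s : ℤ × ℕ) :
    1 / 2 ^ s.2 ≤ 1 / 2 * latticeWeight s := by
  have h : (1 : ℝ) / 2 ^ s.2 ≤ (3 / 4) ^ s.2 := by
    rw [← one_div_pow]
    exact pow_le_pow_left₀ (by norm_num) (by norm_num) _
  linarith [three_quarters_pow_le_latticeWeight s]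

theorem one_add_abs_le_latticeWeight (x : ℤ) : 1 + |(x : ℝ)| ≤ 2 * latticeWeight (x, 0) := by
  have := le_latticeWeight (x, 0)
  have hy : 0 ≤ |(x : ℝ)| := abs_nonneg _
  simp only [pow_zero, div_one] at this
  linarith

/-- A function of the position alone does not change along vertical edges, and its horizontal
increments are of order `2 ^ (-j)`, well below the weight. Only killing at level zero leaves an
error as large as `f` itself, whence the growth condition there. -/
theorem norm_killedStep_sub_le {f : ℤ × ℕ → ℂ} {B : ℝ}
    (hh : ∀ x j, ‖f (x + 1, j) - f (x, j)‖ ≤ B / 2 ^ j) (hd : ∀ x j, f (2 * x, j + 1) = f (x, j))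
    (h0 : ∀ x, ‖f (x, 0)‖ ≤ B * (1 + |(x : ℝ)|)) (s : ℤ × ℕ) :
    ‖(killedStep f - f) s‖ ≤ B * latticeWeight s := by
  obtain ⟨x, j⟩ := s
  have hB : 0 ≤ B := by simpa using (norm_nonneg _).trans (h0 0)
  have hdeg := latticeDeg_pos x
  have e : (killedStep f - f) (x, j)
      = (latticeSum f (x, j) - latticeDeg x * f (x, j)) / latticeDeg x := by
    have : (latticeDeg x : ℂ) ≠ 0 := by exact_mod_cast hdeg.ne'
    rw [Pi.sub_apply, killedStep_apply]
    field_simp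
  rw [e, norm_div, Complex.norm_real, Real.norm_of_nonneg hdeg.le, div_le_iff₀ hdeg]
  have h1 := hh x j
  have h2 := hh (x - 1) j
  rw [sub_add_cancel, norm_sub_rev] at h2
  have hu := one_div_two_pow_le_latticeWeight (x, j)
  have hV := latticeWeight_pos (x, j)
  have h3 := three_le_latticeDeg x
  have hBu : B / 2 ^ j ≤ B * (1 / 2 * latticeWeight (x, j)) := by
    rw [div_eq_mul_one_div]
    gcongr
  have hup : ‖latticeUp f (x, j) - (latticeDeg x - 3) * f (x, j)‖
      ≤ if j = 0 then B * (1 + |(x : ℝ)|) else 0 := by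
    by_cases hx : Even x
    · rcases j with _ | j
      · have := h0 x
        simp only [latticeUp, latticeDeg, hx]
        norm_num
        exact this
      · obtain ⟨m, rfl⟩ := hx.exists_two_nsmul
        simp only [nsmul_eq_mul, Nat.cast_ofNat, latticeUp, latticeDeg, even_two_mul, if_true]
        rw [Int.mul_ediv_cancel_left _ two_ne_zero, hd]
        norm_num
    · have : 0 ≤ B * (1 + |(x : ℝ)|) := by positivity
      rcases j with _ | j <;> simp [latticeUp, latticeDeg, hx, this]
  have hup' : (if j = 0 then B * (1 + |(x : ℝ)|) else 0) ≤ B * (2 * latticeWeight (x, j)) := by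
    split_ifs with hj
    · subst hj
      gcongr
      exact one_add_abs_le_latticeWeight x
    · positivity
  have split : latticeSum f (x, j) - latticeDeg x * f (x, j)
      = (f (x + 1, j) - f (x, j)) + (f (x - 1, j) - f (x, j))
        + (latticeUp f (x, j) - (latticeDeg x - 3) * f (x, j)) := by
    simp only [latticeSum, hd]
    ring
  rw [split]
  refine (norm_add₃_le).trans ?_
  nlinarith [mul_nonneg hB hV.le]

/-- The function `exp (i θ y)` of the horizontal position `y` on the half lattice. -/
noncomputable def latticeWave (θ : ℝ) (s : ℤ × ℕ) : ℂ :=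
  Complex.exp ((θ * (s.1 / 2 ^ s.2) : ℝ) * Complex.I)

theorem norm_latticeWave (θ : ℝ) (s : ℤ × ℕ) : ‖latticeWave θ s‖ = 1 :=
  Complex.norm_exp_ofReal_mul_I _

theorem norm_latticeWave_step_le (θ : ℝ) (x : ℤ) (j : ℕ) :
    ‖latticeWave θ (x + 1, j) - latticeWave θ (x, j)‖ ≤ |θ| / 2 ^ j := by
  refine (norm_exp_mul_I_sub_le _ _).trans (le_of_eq ?_)
  simp only
  rw [← mul_sub, ← sub_div]
  push_cast
  rw [add_sub_cancel_left, abs_mul, abs_div, abs_one, abs_of_pos (by positivity : (0 : ℝ) < 2 ^ j)]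
  ring

theorem latticeWave_down (θ : ℝ) (x : ℤ) (j : ℕ) :
    latticeWave θ (2 * x, j + 1) = latticeWave θ (x, j) := by
  simp only [latticeWave]
  congr 4
  push_cast
  rw [pow_succ]
  field_simp

theorem latticeWave_succ (θ : ℝ) (x : ℤ) (j : ℕ) :
    latticeWave θ (x, j + 1) = latticeWave (θ / 2) (x, j) := by
  simp only [latticeWave]
  congr 3
  rw [pow_succ]
  field_simp

theorem latticeWave_shift (θ : ℝ) (b : ℤ) :
    latticeShift b (latticeWave θ) = Complex.exp ((θ * b : ℝ) * Complex.I) • latticeWave θ := by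
  funext ⟨x, j⟩
  simp only [latticeShift, latticeWave, Pi.smul_apply, smul_eq_mul]
  rw [← Complex.exp_add, ← add_mul]
  congr 2
  push_cast
  field_simp
  ring

theorem latticeWave_defect_bound (θ : ℝ) (s : ℤ × ℕ) :
    ‖(killedStep (latticeWave θ) - latticeWave θ) s‖ ≤ (|θ| + 1) * latticeWeight s := by
  refine norm_killedStep_sub_le (fun x j => ?_) (latticeWave_down θ) (fun x => ?_) s
  · refine (norm_latticeWave_step_le θ x j).trans ?_
    gcongr
    linarith
  · rw [norm_latticeWave]
    nlinarith [abs_nonneg θ, abs_nonneg (x : ℝ), mul_nonneg (abs_nonneg θ) (abs_nonneg (x : ℝ))]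

/-- The expectation of `exp (i θ Y)` over the walks on the half lattice that are never killed,
where `Y` is the limit of the horizontal position. -/
noncomputable def escapeWave (θ : ℝ) : ℤ × ℕ → ℂ :=
  latticeWave θ + neumann killedStep (killedStep (latticeWave θ) - latticeWave θ)

theorem killedStep_escapeWave (θ : ℝ) : killedStep (escapeWave θ) = escapeWave θ := by
  rw [escapeWave, map_add, killedStep_contracts.map_neumann (by norm_num) (by norm_num)
    (latticeWave_defect_bound θ)]
  abel

theorem exists_norm_escapeWave_sub_le (θ : ℝ) :
    ∃ C : ℝ, 0 ≤ C ∧ ∀ s, ‖escapeWave θ s - latticeWave θ s‖ ≤ C * latticeWeight s := by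
  refine ⟨(|θ| + 1) * (1 - 191 / 192)⁻¹, by positivity, fun s => ?_⟩
  rw [escapeWave, Pi.add_apply, add_sub_cancel_left]
  exact killedStep_contracts.norm_neumann_le (by norm_num) (by norm_num)
    (latticeWave_defect_bound θ) s

/-- The difference of two harmonic functions close to the same wave is dominated by the weight, so
the contraction kills it. The translation rule and the factorisation of `escapeWave` are both
obtained from this. -/
theorem escapeWave_unique {θ C : ℝ} {f : ℤ × ℕ → ℂ}
    (hf : ∀ s, ‖f s - latticeWave θ s‖ ≤ C * latticeWeight s) (h : killedStep f = f) :
    f = escapeWave θ := by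
  obtain ⟨C', -, hC'⟩ := exists_norm_escapeWave_sub_le θ
  rw [← sub_eq_zero]
  refine killedStep_contracts.eq_zero (by norm_num) (by norm_num) (C := C + C') (fun s => ?_) ?_
  · rw [add_mul, Pi.sub_apply, ← sub_sub_sub_cancel_right _ _ (latticeWave θ s)]
    exact (norm_sub_le _ _).trans (add_le_add (hf s) (hC' s))
  · rw [map_sub, h, killedStep_escapeWave]

/-- An odd translation would exchange the parities at level zero, hence the degrees. At level `j >
0` the shift by `2 ^ j * b` is even for every `b`. -/
theorem latticeShift_killedStep (a : ℤ) (f : ℤ × ℕ → ℂ) :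
    killedStep (latticeShift (2 * a) f) = latticeShift (2 * a) (killedStep f) := by
  funext s
  have : latticeDeg (s.1 + 2 ^ s.2 * (2 * a)) = latticeDeg s.1 := by
    simp [latticeDeg, Int.even_add]
  rw [killedStep_apply, latticeSum_latticeShift]
  simp only [latticeShift, killedStep_apply, this]

theorem norm_latticeShift_le {f : ℤ × ℕ → ℂ} {C : ℝ} (hf : ∀ s, ‖f s‖ ≤ C * latticeWeight s)
    (b : ℤ) (s : ℤ × ℕ) : ‖latticeShift b f s‖ ≤ C * (2 * (1 + |(b : ℝ)|)) * latticeWeight s := by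
  have hC := nonneg_of_norm_le hf
  rw [mul_assoc]
  exact (hf _).trans (mul_le_mul_of_nonneg_left (latticeWeight_shift_le b s) hC)

theorem escapeWave_shift (θ : ℝ) (a : ℤ) :
    latticeShift (2 * a) (escapeWave θ)
      = Complex.exp ((θ * (2 * a : ℤ) : ℝ) * Complex.I) • escapeWave θ := by
  set e := Complex.exp ((θ * (2 * a : ℤ) : ℝ) * Complex.I) with he
  have he0 : e ≠ 0 := Complex.exp_ne_zero _
  have hen : ‖e⁻¹‖ = 1 := by rw [norm_inv, he, Complex.norm_exp_ofReal_mul_I, inv_one]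
  obtain ⟨C, -, hC⟩ := exists_norm_escapeWave_sub_le θ
  have key : e⁻¹ • latticeShift (2 * a) (escapeWave θ) = escapeWave θ := by
    refine escapeWave_unique (C := C * (2 * (1 + |((2 * a : ℤ) : ℝ)|))) (fun s => ?_) ?_
    · have h1 := norm_latticeShift_le (f := escapeWave θ - latticeWave θ) hC (2 * a) s
      have h2 := congrFun (latticeWave_shift θ (2 * a)) s
      rw [Pi.smul_apply, smul_eq_mul, ← he] at h2
      have h3 : (e⁻¹ • latticeShift (2 * a) (escapeWave θ)) s - latticeWave θ s
          = e⁻¹ * latticeShift (2 * a) (escapeWave θ - latticeWave θ) s := by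
        have : latticeShift (2 * a) (escapeWave θ - latticeWave θ) s
          = latticeShift (2 * a) (escapeWave θ) s - latticeShift (2 * a) (latticeWave θ) s := rfl
        rw [this, h2, Pi.smul_apply, smul_eq_mul]
        field_simp
      rw [h3, norm_mul, hen, one_mul]
      exact h1
    · rw [map_smul, latticeShift_killedStep, killedStep_escapeWave]
  rw [← key, smul_smul, mul_inv_cancel₀ he0, one_smul, key]

/-- The value at the origin of `escapeWave θ`. -/
noncomputable def escapeChar (θ : ℝ) : ℂ := escapeWave θ (0, 0)

/-- Needed only for continuity at zero. The difference of the two waves vanishes at the origin and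
has a defect of size `|θ|` in the weighted norm, so the Neumann bound gives the constant `192 * 96 =
18432`. -/
theorem norm_escapeChar_sub_le (θ : ℝ) : ‖escapeChar θ - escapeChar 0‖ ≤ 20000 * |θ| := by
  set δ : ℤ × ℕ → ℂ := latticeWave θ - latticeWave 0 with hδ
  have h0 (s) : latticeWave 0 s = 1 := by simp [latticeWave]
  have hb : ∀ s, ‖(killedStep δ - δ) s‖ ≤ |θ| * latticeWeight s := by
    refine norm_killedStep_sub_le (fun x j => ?_) (fun x j => ?_) (fun x => ?_)
    · simpa [hδ, h0] using norm_latticeWave_step_le θ x j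
    · simp only [hδ, Pi.sub_apply, h0, latticeWave_down]
    · have := norm_exp_mul_I_sub_le (θ * (x / 2 ^ 0)) 0
      simp only [hδ, Pi.sub_apply, h0]
      simp only [Complex.ofReal_zero, zero_mul, Complex.exp_zero, sub_zero] at this
      refine (show _ ≤ _ from this).trans ?_
      rw [pow_zero, div_one, abs_mul]
      gcongr
      linarith
  have hE : escapeWave θ - escapeWave 0 = δ + neumann killedStep (killedStep δ - δ) := by
    have : neumann killedStep (killedStep (latticeWave θ) - latticeWave θ)
        - neumann killedStep (killedStep (latticeWave 0) - latticeWave 0)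
        = neumann killedStep (killedStep δ - δ) := by
      refine killedStep_contracts.eq_neumann (by norm_num) (by norm_num) hb
        (C' := (|θ| + 1) * (1 - 191 / 192)⁻¹ + (|0| + 1) * (1 - 191 / 192)⁻¹) (fun s => ?_) ?_
      · rw [add_mul]
        refine (norm_sub_le _ _).trans (add_le_add ?_ ?_) <;>
          exact killedStep_contracts.norm_neumann_le (by norm_num) (by norm_num)
            (latticeWave_defect_bound _) s
      · rw [map_sub, killedStep_contracts.map_neumann (by norm_num) (by norm_num)
          (latticeWave_defect_bound θ), killedStep_contracts.map_neumann (by norm_num)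
          (by norm_num) (latticeWave_defect_bound 0), hδ, map_sub]
        abel
    rw [← this, escapeWave, escapeWave, hδ]
    exact add_sub_add_comm _ _ _ _
  have h1 := congrFun hE (0, 0)
  have h2 := killedStep_contracts.norm_neumann_le (by norm_num) (by norm_num) hb (0, 0)
  have h3 : δ (0, 0) = 0 := by simp [hδ, latticeWave]
  rw [Pi.add_apply, Pi.sub_apply, h3, zero_add] at h1
  rw [escapeChar, escapeChar, h1]
  refine h2.trans ?_
  have : latticeWeight (0, 0) = 96 := by simp [latticeWeight]
  rw [this]
  linarith [abs_nonneg θ]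

end Waves

/-! ### Last exit from level zero -/

section Exit

/-- The chance of leaving level zero downwards in one step, weighted by `w`. -/
noncomputable def exitSource (w : ℤ → ℂ) (s : ℤ × ℕ) : ℂ :=
  if s.2 = 0 then w s.1 / latticeDeg s.1 else 0

/-- The total weight `w` of the downward steps from level zero. -/
noncomputable def exitPotential (w : ℤ → ℂ) : ℤ × ℕ → ℂ := neumann killedStep (exitSource w)

theorem norm_exitSource_le {w : ℤ → ℂ} (hw : ∀ x, ‖w x‖ ≤ 1 + |(x : ℝ)|) (s : ℤ × ℕ) :
    ‖exitSource w s‖ ≤ 1 * latticeWeight s := by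
  obtain ⟨x, j⟩ := s
  have hV := latticeWeight_pos (x, j)
  unfold exitSource
  split_ifs with hj
  · simp only at hj
    subst hj
    have h3 := three_le_latticeDeg x
    rw [norm_div, Complex.norm_real, Real.norm_of_nonneg (latticeDeg_pos _).le,
      div_le_iff₀ (latticeDeg_pos _)]
    have := hw x
    have := one_add_abs_le_latticeWeight x
    nlinarith
  · simpa using hV.le

theorem norm_exitPotential_le {w : ℤ → ℂ} (hw : ∀ x, ‖w x‖ ≤ 1 + |(x : ℝ)|) (s : ℤ × ℕ) :
    ‖exitPotential w s‖ ≤ 192 * latticeWeight s := by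
  have := killedStep_contracts.norm_neumann_le (by norm_num) (by norm_num)
    (norm_exitSource_le hw) s
  norm_num at this
  exact this

theorem killedStep_exitPotential {w : ℤ → ℂ} (hw : ∀ x, ‖w x‖ ≤ 1 + |(x : ℝ)|) :
    killedStep (exitPotential w) = exitPotential w - exitSource w :=
  killedStep_contracts.map_neumann (by norm_num) (by norm_num) (norm_exitSource_le hw)

theorem eq_exitPotential {w : ℤ → ℂ} (hw : ∀ x, ‖w x‖ ≤ 1 + |(x : ℝ)|) {g : ℤ × ℕ → ℂ} {C : ℝ}
    (hg : ∀ s, ‖g s‖ ≤ C * latticeWeight s) (h : killedStep g = g - exitSource w) :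
    g = exitPotential w :=
  killedStep_contracts.eq_neumann (by norm_num) (by norm_num) (norm_exitSource_le hw) hg h

/-- Extension by zero to level zero of a function that is moved down by one level. -/
def latticeDescend (f : ℤ × ℕ → ℂ) : ℤ × ℕ → ℂ
  | (_, 0) => 0
  | (x, j + 1) => f (x, j)

theorem latticeSum_latticeDescend_succ (f : ℤ × ℕ → ℂ) (x : ℤ) (j : ℕ) :
    latticeSum (latticeDescend f) (x, j + 1) = latticeSum f (x, j) := by
  rcases j with _ | j <;> simp [latticeSum, latticeDescend, latticeUp]

theorem latticeSum_latticeDescend_zero (f : ℤ × ℕ → ℂ) (x : ℤ) :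
    latticeSum (latticeDescend f) (x, 0) = f (2 * x, 0) := by
  simp [latticeSum, latticeDescend, latticeUp]

theorem latticeWeight_le_succ (x : ℤ) (j : ℕ) :
    latticeWeight (x, j) ≤ 3 * latticeWeight (x, j + 1) := by
  have hy : 0 ≤ |(x : ℝ)| / 2 ^ j := by positivity
  have h : |(x : ℝ)| / 2 ^ (j + 1) = |(x : ℝ)| / 2 ^ j / 2 := by
    rw [pow_succ]
    field_simp
  simp only [latticeWeight, h]
  rw [pow_succ]
  have hq : 0 ≤ ((3 / 4) ^ j : ℝ) * (if Even x then 1 else 15 / 16) := by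
    split_ifs <;> positivity
  nlinarith [mul_nonneg hq hy]

/-- The phases `exp (i θ x)`. -/
noncomputable def phase (θ : ℝ) (x : ℤ) : ℂ := Complex.exp ((θ * x : ℝ) * Complex.I)

theorem norm_phase (θ : ℝ) (x : ℤ) : ‖phase θ x‖ = 1 := Complex.norm_exp_ofReal_mul_I _

theorem norm_phase_le (θ : ℝ) (x : ℤ) : ‖phase θ x‖ ≤ 1 + |(x : ℝ)| := by
  rw [norm_phase]
  linarith [abs_nonneg (x : ℝ)]

theorem phase_add (θ : ℝ) (x y : ℤ) : phase θ (x + y) = phase θ x * phase θ y := by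
  simp only [phase]
  rw [← Complex.exp_add]
  congr 1
  push_cast
  ring

theorem phase_zero_right (θ : ℝ) : phase θ 0 = 1 := by simp [phase]

/-- The characteristic function of the horizontal displacement up to the last exit from
level zero. -/
noncomputable def exitChar (θ : ℝ) : ℂ := exitPotential (phase θ) (0, 0)

/-- A walk that is never killed has a last step down from level zero, say from `(x, 0)` to `(2 * x,
1)`. Afterwards it lives on the levels from one on, a copy of the half lattice with positions
halved, whence `θ / 2`; by `escapeWave_shift` its start at `2 * x` contributes `phase θ x *
escapeChar (θ / 2)`. The term with `latticeDescend` stands for walks starting below level zero that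
never reach it. The sum is harmonic and close to the wave, so uniqueness applies. -/
theorem escapeChar_eq_mul (θ : ℝ) : escapeChar θ = escapeChar (θ / 2) * exitChar θ := by
  obtain ⟨C, hC0, hC⟩ := exists_norm_escapeWave_sub_le (θ / 2)
  have key : latticeDescend (escapeWave (θ / 2)) + escapeChar (θ / 2) • exitPotential (phase θ)
      = escapeWave θ := by
    refine escapeWave_unique (C := 3 * C + 1 + ‖escapeChar (θ / 2)‖ * 192) (fun s => ?_) ?_
    · have h1 := norm_exitPotential_le (norm_phase_le θ) s
      have h2 : ‖latticeDescend (escapeWave (θ / 2)) s - latticeWave θ s‖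
          ≤ (3 * C + 1) * latticeWeight s := by
        have hV := latticeWeight_pos s
        obtain ⟨x, _ | j⟩ := s
        · have hW := one_div_two_pow_le_latticeWeight (x, 0)
          simp only [pow_zero, div_one] at hW
          simp only [latticeDescend, zero_sub, norm_neg, norm_latticeWave]
          nlinarith [mul_nonneg hC0 hV.le]
        · simp only [latticeDescend, latticeWave_succ]
          refine (hC _).trans ?_
          have := mul_le_mul_of_nonneg_left (latticeWeight_le_succ x j) hC0
          linarith
      rw [Pi.add_apply, add_sub_right_comm, Pi.smul_apply, smul_eq_mul, add_mul _ (_ * _), mul_assoc]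
      refine (norm_add_le _ _).trans (add_le_add h2 ?_)
      rw [norm_mul]
      gcongr
    · rw [map_add, map_smul, killedStep_exitPotential (norm_phase_le θ)]
      have : killedStep (latticeDescend (escapeWave (θ / 2)))
          = latticeDescend (escapeWave (θ / 2)) + escapeChar (θ / 2) • exitSource (phase θ) := by
        funext ⟨x, j⟩
        rw [Pi.add_apply, Pi.smul_apply, smul_eq_mul]
        rcases j with _ | j
        · rw [killedStep_apply, latticeSum_latticeDescend_zero]
          have := congrFun (escapeWave_shift (θ / 2) x) (0, 0)
          simp only [latticeShift, pow_zero, one_mul, zero_add, Pi.smul_apply, smul_eq_mul] at this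
          rw [this]
          simp only [exitSource, latticeDescend, if_true, phase, escapeChar, zero_add]
          push_cast
          ring_nf
        · rw [killedStep_apply, latticeSum_latticeDescend_succ]
          have := congrFun (killedStep_escapeWave (θ / 2)) (x, j)
          rw [killedStep_apply] at this
          simp [exitSource, latticeDescend, this]
      rw [this, smul_sub]
      abel
  have := congrFun key (0, 0)
  simp only [Pi.add_apply, Pi.smul_apply, smul_eq_mul, latticeDescend, zero_add] at this
  exact this.symm

theorem exitPotential_phase_shift (θ : ℝ) (a : ℤ) :
    latticeShift (2 * a) (exitPotential (phase θ))
      = phase θ (2 * a) • exitPotential (phase θ) := by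
  set e := phase θ (2 * a) with he
  have hen : ‖e⁻¹‖ = 1 := by rw [norm_inv, he, norm_phase, inv_one]
  have he0 : e ≠ 0 := Complex.exp_ne_zero _
  have hb := norm_exitPotential_le (norm_phase_le θ)
  have key : e⁻¹ • latticeShift (2 * a) (exitPotential (phase θ)) = exitPotential (phase θ) := by
    refine eq_exitPotential (norm_phase_le θ) (C := 192 * (2 * (1 + |((2 * a : ℤ) : ℝ)|)))
      (fun s => ?_) ?_
    · rw [Pi.smul_apply, smul_eq_mul, norm_mul, hen, one_mul]
      exact norm_latticeShift_le hb _ s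
    · rw [map_smul, latticeShift_killedStep, killedStep_exitPotential (norm_phase_le θ)]
      funext ⟨x, j⟩
      simp only [Pi.sub_apply, Pi.smul_apply, smul_eq_mul, latticeShift, exitSource]
      split_ifs with hj
      · have : latticeDeg (x + 2 ^ j * (2 * a)) = latticeDeg x := by
          simp [latticeDeg, Int.even_add]
        rw [this, hj, pow_zero, one_mul, phase_add, ← he]
        field_simp
      · ring
  rw [← key, smul_smul, mul_inv_cancel₀ he0, one_smul, key]

/-- If `exitChar θ = 0`, even translations make the potential `g` vanish at all even sites of level
zero, exactly those with the exceptional degree. The equation for `g` then no longer sees parity at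
level zero, so `g` is equivariant under odd translations as well. Hence `g` vanishes on level zero,
then below it, which contradicts the source at the origin. -/
theorem exitChar_ne_zero (θ : ℝ) : exitChar θ ≠ 0 := by
  intro h
  set g := exitPotential (phase θ) with hg
  have hb := norm_exitPotential_le (norm_phase_le θ)
  rw [← hg] at hb
  have heven (a : ℤ) : g (2 * a, 0) = 0 := by
    have := congrFun (exitPotential_phase_shift θ a) (0, 0)
    simp only [latticeShift, pow_zero, one_mul, zero_add, Pi.smul_apply, smul_eq_mul] at this
    rw [hg, this]
    exact mul_eq_zero_of_right _ h
  have hstep (s : ℤ × ℕ) : latticeSum g s = latticeDeg s.1 * (g s - exitSource (phase θ) s) := by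
    have := congrFun (killedStep_exitPotential (norm_phase_le θ)) s
    rw [killedStep_apply, Pi.sub_apply, ← hg] at this
    have h0 : (latticeDeg s.1 : ℂ) ≠ 0 := by exact_mod_cast (latticeDeg_pos s.1).ne'
    rw [← this]
    field_simp
  -- At even sites `g` is zero, so the degree `4` may be replaced by `3`.
  have hstep0 (x : ℤ) : latticeSum g (x, 0) = 3 * g (x, 0) - phase θ x := by
    rw [hstep]
    have h0 : (latticeDeg x : ℂ) ≠ 0 := by exact_mod_cast (latticeDeg_pos x).ne'
    simp only [exitSource, if_true]
    by_cases hx : Even x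
    · obtain ⟨m, rfl⟩ := hx.exists_two_nsmul
      simp only [nsmul_eq_mul, Nat.cast_ofNat, heven] at *
      field_simp
      ring
    · rw [mul_sub, mul_div_cancel₀ _ h0]
      simp [latticeDeg, hx]
  set D : ℤ × ℕ → ℂ := latticeShift 1 g - phase θ 1 • g with hD
  have hDsum (s : ℤ × ℕ) : latticeSum D s
      = latticeSum g (s.1 + 2 ^ s.2 * 1, s.2) - phase θ 1 * latticeSum g s := by
    rw [← latticeSum_latticeShift]
    obtain ⟨x, j⟩ := s
    rcases j with _ | j <;>
      simp only [hD, latticeSum, latticeUp, Pi.sub_apply, Pi.smul_apply, smul_eq_mul]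
    · ring
    · split_ifs <;> ring
  have hDharm (s : ℤ × ℕ) :
      latticeSum D s = (if s.2 ≠ 0 ∧ Even s.1 then 4 else 3) * D s := by
    obtain ⟨x, j⟩ := s
    rw [hDsum]
    rcases j with _ | j
    · simp only [pow_zero, one_mul, hstep0, phase_add]
      simp [hD, latticeShift]
      ring
    · have hd : latticeDeg (x + 2 ^ (j + 1) * 1) = latticeDeg x := by
        simp [latticeDeg, Int.even_add, pow_succ]
      rw [hstep, hstep, hd]
      simp only [exitSource, Nat.succ_ne_zero, if_false, sub_zero, ne_eq, not_false_eq_true,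
        true_and, hD, Pi.sub_apply, Pi.smul_apply, smul_eq_mul, latticeShift, latticeDeg]
      split_ifs <;> push_cast <;> ring
  -- `D` is harmonic with degree `3` on all of level zero, that is, for a reflected instead of a
  -- killed walk. This is where `norm_latticeSum_le` is needed in its sharper form.
  have hD0 : D = 0 := by
    refine eq_zero_of_contraction (V := latticeWeight) (r := 191 / 192) (by norm_num)
      (by norm_num) (C := 192 * (2 * (1 + |((1 : ℤ) : ℝ)|)) + 192) (fun s => ?_) (fun C hC s => ?_)
    · rw [add_mul]
      refine (norm_sub_le _ _).trans (add_le_add (norm_latticeShift_le hb _ s) ?_)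
      rw [Pi.smul_apply, smul_eq_mul, norm_mul, norm_phase, one_mul]
      exact hb s
    · have h1 := norm_latticeSum_le hC s
      rw [hDharm, norm_mul] at h1
      split_ifs at h1
      · have : ‖(4 : ℂ)‖ = 4 := by norm_num
        rw [this] at h1
        linarith
      · have : ‖(3 : ℂ)‖ = 3 := by norm_num
        rw [this] at h1
        linarith
  have hodd (a : ℤ) : g (2 * a + 1, 0) = 0 := by
    have := congrFun hD0 (2 * a, 0)
    simpa [hD, latticeShift, heven] using this
  have hzero (x : ℤ) : g (x, 0) = 0 := by
    obtain ⟨a, rfl | rfl⟩ := Int.even_or_odd' x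
    · exact heven a
    · exact hodd a
  -- Since `g` is zero on level zero, the levels below form a killed half lattice of their own,
  -- without source.
  set E : ℤ × ℕ → ℂ := fun s => g (s.1, s.2 + 1) with hE
  have hdesc : g = latticeDescend E := by
    funext s
    obtain ⟨x, _ | j⟩ := s
    · simp [latticeDescend, hzero]
    · rfl
  have hE0 : E = 0 := by
    refine killedStep_contracts.eq_zero (by norm_num) (by norm_num) (C := 192) (fun s => ?_) ?_
    · refine (hb _).trans ?_
      gcongr
      obtain ⟨x, j⟩ := s
      have hy : 0 ≤ |(x : ℝ)| / 2 ^ j := by positivity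
      have h : |(x : ℝ)| / 2 ^ (j + 1) = |(x : ℝ)| / 2 ^ j / 2 := by
        rw [pow_succ]
        field_simp
      simp only [latticeWeight, h]
      rw [pow_succ]
      have hq : 0 ≤ ((3 / 4) ^ j : ℝ) * (if Even x then 1 else 15 / 16) := by
        split_ifs <;> positivity
      nlinarith [mul_nonneg hq hy]
    · funext ⟨x, j⟩
      have h0 : (latticeDeg x : ℂ) ≠ 0 := by exact_mod_cast (latticeDeg_pos x).ne'
      have := hstep (x, j + 1)
      rw [killedStep_apply, ← latticeSum_latticeDescend_succ, ← hdesc, this]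
      simp only [exitSource, Nat.succ_ne_zero, if_false, sub_zero, hE]
      field_simp
  have hfin := hstep0 0
  rw [hdesc, latticeSum_latticeDescend_zero, hE0, phase_zero_right] at hfin
  simp [latticeDescend] at hfin

end Exit

/-! ### The exit position as an integer law with a first moment -/

section ExitLaw

open scoped ComplexOrder

theorem killedStep_nonneg {f : ℤ × ℕ → ℂ} (hf : 0 ≤ f) : 0 ≤ killedStep f := by
  intro s
  have hdeg : (0 : ℂ) ≤ (latticeDeg s.1 : ℂ) := by exact_mod_cast (latticeDeg_pos s.1).le
  have hup : 0 ≤ latticeUp f s := by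
    obtain ⟨x, _ | j⟩ := s
    · exact le_rfl
    · simp only [latticeUp]
      split_ifs
      · exact hf _
      · exact le_rfl
  exact div_nonneg (add_nonneg (add_nonneg (add_nonneg (hf _) (hf _)) (hf _)) hup) hdeg

theorem neumann_killedStep_nonneg {c : ℤ × ℕ → ℂ} (hc : 0 ≤ c) : 0 ≤ neumann killedStep c := by
  have h (t : ℕ) : 0 ≤ (killedStep ^ t) c := by
    induction t with
    | zero => exact hc
    | succ t ih =>
      rw [pow_succ']
      exact killedStep_nonneg ih
  exact fun s => tsum_nonneg fun t => h t s

theorem norm_single_le (x y : ℤ) : ‖(Pi.single x 1 : ℤ → ℂ) y‖ ≤ 1 + |(y : ℝ)| := by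
  by_cases h : y = x
  · subst h
    simp
  · rw [Pi.single_eq_of_ne h, norm_zero]
    positivity

theorem exitPotential_single_nonneg (x : ℤ) (s : ℤ × ℕ) :
    0 ≤ exitPotential (Pi.single x 1) s := by
  refine neumann_killedStep_nonneg (fun s => ?_) s
  have hdeg : (0 : ℂ) ≤ (latticeDeg s.1 : ℂ) := by exact_mod_cast (latticeDeg_pos s.1).le
  simp only [exitSource]
  split_ifs
  · refine div_nonneg ?_ hdeg
    by_cases h : s.1 = x
    · rw [h, Pi.single_eq_same]
      exact zero_le_one
    · rw [Pi.single_eq_of_ne h]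
  · exact le_rfl

theorem exitSource_single (x : ℤ) (s : ℤ × ℕ) :
    exitSource (Pi.single x 1) s = if x = s.1 then exitSource 1 s else 0 := by
  by_cases h : x = s.1
  · subst h
    simp [exitSource]
  · simp [exitSource, h]

theorem exitSource_eq_mul (w : ℤ → ℂ) (s : ℤ × ℕ) : exitSource w s = w s.1 * exitSource 1 s := by
  simp only [exitSource, Pi.one_apply]
  split_ifs <;> ring

theorem sum_smul_exitPotential_single {w : ℤ → ℂ} (hw : ∀ x, ‖w x‖ ≤ 1 + |(x : ℝ)|)
    (F : Finset ℤ) : ∑ x ∈ F, w x • exitPotential (Pi.single x 1)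
      = exitPotential (fun y => if y ∈ F then w y else 0) := by
  refine eq_exitPotential (fun x => ?_) (C := ∑ x ∈ F, ‖w x‖ * 192) (fun s => ?_) ?_
  · split_ifs
    · exact hw x
    · rw [norm_zero]
      positivity
  · rw [Finset.sum_apply, Finset.sum_mul]
    refine (norm_sum_le _ _).trans (Finset.sum_le_sum fun x _ => ?_)
    rw [Pi.smul_apply, norm_smul, mul_assoc]
    exact mul_le_mul_of_nonneg_left (norm_exitPotential_le (norm_single_le x) s) (norm_nonneg _)
  · simp only [map_sum, map_smul, killedStep_exitPotential (norm_single_le _), smul_sub,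
      Finset.sum_sub_distrib]
    congr 1
    funext s
    rw [exitSource_eq_mul, Finset.sum_apply]
    simp [exitSource_single, Finset.sum_ite_eq', ite_mul]

/-- All terms are nonnegative, so the sum of norms is the potential of one truncated weight, which
is bounded independently of `F`. Allowing weights of linear growth is what yields the first moment.
-/
theorem sum_norm_exitPotential_single_le (F : Finset ℤ) (s : ℤ × ℕ) :
    ∑ x ∈ F, ‖((1 + |(x : ℝ)| : ℝ) : ℂ) * exitPotential (Pi.single x 1) s‖
      ≤ 192 * latticeWeight s := by
  have hw (x : ℤ) : ‖((1 + |(x : ℝ)| : ℝ) : ℂ)‖ ≤ 1 + |(x : ℝ)| := by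
    rw [Complex.norm_real, Real.norm_of_nonneg (by positivity)]
  have hn (x : ℤ) : (0 : ℂ) ≤ ((1 + |(x : ℝ)| : ℝ) : ℂ) * exitPotential (Pi.single x 1) s :=
    mul_nonneg (by exact_mod_cast (by positivity : (0 : ℝ) ≤ 1 + |(x : ℝ)|))
      (exitPotential_single_nonneg x s)
  have h := congrFun (sum_smul_exitPotential_single hw F) s
  rw [Finset.sum_apply] at h
  simp only [Pi.smul_apply, smul_eq_mul] at h
  have e : ((∑ x ∈ F, ‖((1 + |(x : ℝ)| : ℝ) : ℂ) * exitPotential (Pi.single x 1) s‖ : ℝ) : ℂ)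
      = ∑ x ∈ F, ((1 + |(x : ℝ)| : ℝ) : ℂ) * exitPotential (Pi.single x 1) s := by
    rw [Complex.ofReal_sum]
    exact Finset.sum_congr rfl fun x _ => (Complex.norm_of_nonneg' (hn x))
  refine (le_abs_self _).trans ?_
  rw [← Real.norm_eq_abs, ← Complex.norm_real, e, h]
  refine norm_exitPotential_le (fun x => ?_) s
  split_ifs
  · exact hw x
  · rw [norm_zero]
    positivity

theorem summable_norm_exitPotential_single (s : ℤ × ℕ) :
    Summable fun x : ℤ => ‖((1 + |(x : ℝ)| : ℝ) : ℂ) * exitPotential (Pi.single x 1) s‖ :=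
  summable_of_sum_le (fun _ => norm_nonneg _) fun F => sum_norm_exitPotential_single_le F s

theorem HasSum.latticeSum {f : ℤ → ℤ × ℕ → ℂ} {g : ℤ × ℕ → ℂ}
    (h : ∀ s, HasSum (fun x => f x s) (g s)) (s : ℤ × ℕ) :
    HasSum (fun x => latticeSum (f x) s) (latticeSum g s) := by
  have hup : HasSum (fun x => latticeUp (f x) s) (latticeUp g s) := by
    obtain ⟨x, _ | j⟩ := s
    · exact hasSum_zero
    · simp only [latticeUp]
      split_ifs
      · exact h _
      · exact hasSum_zero
  exact (((h _).add (h _)).add (h _)).add hup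

theorem hasSum_exitPotential_single {w : ℤ → ℂ} (hw : ∀ x, ‖w x‖ ≤ 1 + |(x : ℝ)|) (s : ℤ × ℕ) :
    HasSum (fun x => w x * exitPotential (Pi.single x 1) s) (exitPotential w s) := by
  have hle (s : ℤ × ℕ) (x : ℤ) : ‖w x * exitPotential (Pi.single x 1) s‖
      ≤ ‖((1 + |(x : ℝ)| : ℝ) : ℂ) * exitPotential (Pi.single x 1) s‖ := by
    rw [norm_mul, norm_mul, Complex.norm_real, Real.norm_of_nonneg (by positivity)]
    gcongr
    exact hw x
  have hsum (s : ℤ × ℕ) : Summable fun x => w x * exitPotential (Pi.single x 1) s :=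
    Summable.of_norm_bounded (summable_norm_exitPotential_single s) (hle s)
  have key : (fun s => ∑' x, w x * exitPotential (Pi.single x 1) s) = exitPotential w := by
    refine eq_exitPotential hw (C := 192) (fun s => ?_) ?_
    · refine (tsum_of_norm_bounded (summable_norm_exitPotential_single s).hasSum (hle s)).trans ?_
      exact (summable_norm_exitPotential_single s).tsum_le_of_sum_le
        fun F => sum_norm_exitPotential_single_le F s
    · funext s
      have h1 := (HasSum.latticeSum (f := fun x => w x • exitPotential (Pi.single x 1))
        (fun s => (hsum s).hasSum) s).div_const (latticeDeg s.1 : ℂ)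
      have h2 (x : ℤ) : latticeSum (w x • exitPotential (Pi.single x 1)) s / latticeDeg s.1
          = w x * exitPotential (Pi.single x 1) s - if x = s.1 then exitSource w s else 0 := by
        rw [← killedStep_apply, map_smul, killedStep_exitPotential (norm_single_le x),
          Pi.smul_apply, Pi.sub_apply, smul_eq_mul, mul_sub, exitSource_single,
          exitSource_eq_mul w]
        split_ifs with hx
        · rw [hx]
        · simp
      simp only [h2] at h1
      exact h1.unique ((hsum s).hasSum.sub (hasSum_ite_eq s.1 _))
  rw [← key]
  exact (hsum s).hasSum

/-- The characteristic function `exitChar` is that of a finite measure on the integers with a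
first moment. -/
theorem exists_exitLaw : ∃ p : ℤ → ℝ, (∀ x, 0 ≤ p x) ∧ Summable (fun x : ℤ => |(x : ℝ)| * p x) ∧
    ∀ θ, HasSum (fun x => phase θ x * p x) (exitChar θ) := by
  have hp (x : ℤ) : ((‖exitPotential (Pi.single x 1) (0, 0)‖ : ℝ) : ℂ)
      = exitPotential (Pi.single x 1) (0, 0) :=
    Complex.norm_of_nonneg' (exitPotential_single_nonneg x _)
  -- The expected number of steps down from `(x, 0)` for the killed walk started at the origin.
  refine ⟨fun x => ‖exitPotential (Pi.single x 1) (0, 0)‖, fun x => norm_nonneg _, ?_, fun θ => ?_⟩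
  · refine (summable_norm_exitPotential_single (0, 0)).of_nonneg_of_le (fun x => by positivity)
      fun x => ?_
    rw [norm_mul, Complex.norm_real, Real.norm_of_nonneg (by positivity)]
    gcongr
    linarith
  · simp only [hp]
    exact hasSum_exitPotential_single (norm_phase_le θ) (0, 0)

end ExitLaw

/-! ### Simple random walk: Markov property, Lyapunov functions, convergence -/

section Walk

variable {nbrs : BitString → Multiset BitString} {h : ∀ w, nbrs w ≠ 0}

instance : IsProbabilityMeasure (srwLaw nbrs h) := by
  unfold srwLaw
  infer_instance

/-- The average of a function over the neighbours of a vertex. -/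
noncomputable def nbrAverage (nbrs : BitString → Multiset BitString) (f : BitString → ℂ)
    (w : BitString) : ℂ := ((nbrs w).map f).sum / Multiset.card (nbrs w)

theorem PMF.integrable_ofMultiset {α : Type*} [MeasurableSpace α] [DiscreteMeasurableSpace α]
    (s : Multiset α) (hs : s ≠ 0) (f : α → ℂ) :
    Integrable f (PMF.ofMultiset s hs).toMeasure := by
  classical
  rw [← (PMF.ofMultiset s hs).restrict_toMeasure_support, PMF.support_ofMultiset]
  exact (IntegrableOn.finset (s := s.toFinset))

theorem PMF.integral_ofMultiset {α : Type*} [MeasurableSpace α] [DiscreteMeasurableSpace α]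
    (s : Multiset α) (hs : s ≠ 0) (f : α → ℂ) :
    ∫ a, f a ∂(PMF.ofMultiset s hs).toMeasure = (s.map f).sum / Multiset.card s := by
  classical
  rw [PMF.integral_eq_tsum _ _ (PMF.integrable_ofMultiset s hs f),
    tsum_eq_sum (s := s.toFinset) (fun a ha => ?_), Finset.sum_multiset_map_count, Finset.sum_div]
  · refine Finset.sum_congr rfl fun a _ => ?_
    rw [PMF.ofMultiset_apply, ENNReal.toReal_div, ENNReal.toReal_natCast, ENNReal.toReal_natCast,
      nsmul_eq_mul, Complex.real_smul]
    push_cast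
    ring
  · rw [PMF.ofMultiset_apply_of_notMem hs (by simpa using ha)]
    simp

theorem PMF.lintegral_ofMultiset_ofReal {α : Type*} [MeasurableSpace α]
    [DiscreteMeasurableSpace α] (s : Multiset α) (hs : s ≠ 0) {V : α → ℝ} (hV : ∀ a, 0 ≤ V a) :
    ∫⁻ a, ENNReal.ofReal (V a) ∂(PMF.ofMultiset s hs).toMeasure
      = ENNReal.ofReal ((s.map V).sum / Multiset.card s) := by
  have hi := PMF.integrable_ofMultiset s hs (fun a => (V a : ℂ))
  have hi' : Integrable V (PMF.ofMultiset s hs).toMeasure := by simpa using hi.re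
  rw [← ofReal_integral_eq_lintegral_ofReal hi' (Eventually.of_forall hV)]
  congr 1
  have := PMF.integral_ofMultiset s hs (fun a => (V a : ℂ))
  rw [integral_complex_ofReal] at this
  apply Complex.ofReal_injective
  rw [this]
  push_cast
  congr 1
  have := map_multiset_sum Complex.ofRealHom (s.map V)
  rw [Multiset.map_map] at this
  exact this.symm

theorem srwKernel_apply (w : BitString) :
    srwKernel nbrs h w = (PMF.ofMultiset (nbrs w) (h w)).toMeasure := rfl

/-- The Markov property in the only form needed: one-step expectations and the adjacency of
consecutive states both come from this joint law. -/
theorem map_pair_srwLaw (t : ℕ) :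
    (srwLaw nbrs h).map (fun X => (X t, X (t + 1)))
      = ((srwLaw nbrs h).map fun X => X t) ⊗ₘ srwKernel nbrs h := by
  have h1 := Kernel.partialTraj_compProd_eq_map_traj (κ := srwHistoryKernel nbrs h)
    (X := fun _ => BitString) (zero_le : 0 ≤ t) (x₀ := fun _ => ([] : BitString))
  rw [← Kernel.traj_map_frestrictLe_apply] at h1
  change (srwLaw nbrs h).map _ ⊗ₘ _ = (srwLaw nbrs h).map _ at h1
  have h2 := congrArg (Measure.map (Prod.map
    (fun x : (i : Finset.Iic t) → (fun _ : ℕ => BitString) i => x ⟨t, Finset.mem_Iic.2 le_rfl⟩)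
    (id : BitString → BitString))) h1
  rw [Measure.map_map (by fun_prop) (by fun_prop)] at h2
  change _ = (srwLaw nbrs h).map (fun X => (X t, X (t + 1))) at h2
  rw [← h2]
  ext s hs
  rw [Measure.map_apply (by fun_prop) hs, Measure.compProd_apply (by measurability),
    Measure.compProd_apply hs, lintegral_map, lintegral_map]
  · rfl
  · exact measurable_of_countable _
  · fun_prop
  · exact Kernel.measurable_kernel_prodMk_left (hs.preimage (by fun_prop))
  · fun_prop

theorem ae_srwLaw_zero : ∀ᵐ X ∂srwLaw nbrs h, X 0 = [] := by
  have h1 := Kernel.traj_map_frestrictLe_apply (κ := srwHistoryKernel nbrs h)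
    (X := fun _ => BitString) 0 0 (fun _ => ([] : BitString))
  rw [Kernel.partialTraj_self, Kernel.id_apply] at h1
  change (srwLaw nbrs h).map _ = _ at h1
  have h3 : ∀ᵐ x ∂(srwLaw nbrs h).map (Preorder.frestrictLe 0),
      x ⟨0, Finset.mem_Iic.2 le_rfl⟩ = [] := by
    rw [h1]
    refine (ae_dirac_iff ?_).2 rfl
    exact measurableSet_eq_fun (measurable_pi_apply _) measurable_const
  exact ae_of_ae_map (by fun_prop) h3

theorem lintegral_srwLaw_succ (t : ℕ) (g : BitString → ENNReal) :
    ∫⁻ X, g (X (t + 1)) ∂srwLaw nbrs h = ∫⁻ X, ∫⁻ y, g y ∂srwKernel nbrs h (X t) ∂srwLaw nbrs h := by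
  have hg : Measurable g := measurable_of_countable _
  have h1 : ∫⁻ X, g (X (t + 1)) ∂srwLaw nbrs h
      = ∫⁻ p, g p.2 ∂(srwLaw nbrs h).map (fun X => (X t, X (t + 1))) := by
    rw [lintegral_map (by fun_prop) (by fun_prop)]
  rw [h1, map_pair_srwLaw, Measure.lintegral_compProd (by fun_prop), lintegral_map
    (measurable_of_countable _) (by fun_prop)]

theorem integrable_srwLaw {f : BitString → ℂ} {B : ℝ} (hf : ∀ w, ‖f w‖ ≤ B) (t : ℕ) :
    Integrable (fun X => f (X t)) (srwLaw nbrs h) :=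
  Integrable.of_bound (((measurable_of_countable f).comp (measurable_pi_apply t)).aestronglyMeasurable)
    B (Eventually.of_forall fun _ => hf _)

theorem integral_srwLaw_succ {f : BitString → ℂ} {B : ℝ} (hf : ∀ w, ‖f w‖ ≤ B) (t : ℕ) :
    ∫ X, f (X (t + 1)) ∂srwLaw nbrs h = ∫ X, nbrAverage nbrs f (X t) ∂srwLaw nbrs h := by
  have hm : Measurable f := measurable_of_countable _
  have hm2 : Measurable fun p : BitString × BitString => f p.2 := hm.comp measurable_snd
  have hXX : Measurable fun X : ℕ → BitString => (X t, X (t + 1)) := by fun_prop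
  have h1 : ∫ X, f (X (t + 1)) ∂srwLaw nbrs h
      = ∫ p, f p.2 ∂(srwLaw nbrs h).map (fun X => (X t, X (t + 1))) := by
    rw [integral_map hXX.aemeasurable hm2.aestronglyMeasurable]
  have hX : Measurable fun X : ℕ → BitString => X t := measurable_pi_apply t
  have : IsProbabilityMeasure ((srwLaw nbrs h).map fun X => X t) :=
    Measure.isProbabilityMeasure_map hX.aemeasurable
  rw [h1, map_pair_srwLaw, Measure.integral_compProd, integral_map hX.aemeasurable
    (measurable_of_countable _).aestronglyMeasurable]
  · refine integral_congr_ae (Eventually.of_forall fun X => ?_)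
    simp only [srwKernel_apply]
    exact PMF.integral_ofMultiset _ _ f
  · exact Integrable.of_bound hm2.aestronglyMeasurable B
      (Eventually.of_forall fun _ => hf _)

theorem integral_srwLaw_zero (f : BitString → ℂ) : ∫ X, f (X 0) ∂srwLaw nbrs h = f [] := by
  rw [integral_congr_ae (g := fun _ => f []) (ae_srwLaw_zero.mono fun X hX => by simp [hX])]
  simp

theorem ae_mem_nbrs : ∀ᵐ X ∂srwLaw nbrs h, ∀ t, X (t + 1) ∈ nbrs (X t) := by
  classical
  rw [ae_all_iff]
  intro t
  have h1 : ∀ᵐ p ∂(srwLaw nbrs h).map (fun X => (X t, X (t + 1))), p.2 ∈ nbrs p.1 := by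
    rw [map_pair_srwLaw]
    rw [Measure.ae_compProd_iff (MeasurableSet.of_discrete)]
    refine Eventually.of_forall fun w => ?_
    rw [srwKernel_apply, ← (PMF.ofMultiset _ _).restrict_toMeasure_support,
      PMF.support_ofMultiset]
    refine (ae_restrict_mem MeasurableSet.of_discrete).mono fun y hy => ?_
    simpa using hy
  exact ae_of_ae_map (by fun_prop) h1

/-- A Lyapunov function for simple random walk that decreases geometrically in mean and
dominates the horizontal steps. -/
structure IsLyapunov (nbrs : BitString → Multiset BitString) (V : BitString → ℝ) (r : ℝ) :
    Prop where
  nonneg : ∀ w, 0 ≤ V w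
  rate_nonneg : 0 ≤ r
  rate_lt_one : r < 1
  sum_le : ∀ w, ((nbrs w).map V).sum ≤ r * Multiset.card (nbrs w) * V w
  dist_le : ∀ w, ∀ w' ∈ nbrs w, dist (circlePosition w) (circlePosition w') ≤ 2 * V w

variable {V : BitString → ℝ} {r : ℝ}

theorem IsLyapunov.lintegral_le (hV : IsLyapunov nbrs V r) (t : ℕ) :
    ∫⁻ X, ENNReal.ofReal (V (X t)) ∂srwLaw nbrs h ≤ ENNReal.ofReal (r ^ t * V []) := by
  induction t with
  | zero =>
    rw [lintegral_congr_ae (g := fun _ => ENNReal.ofReal (V []))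
      (ae_srwLaw_zero.mono fun X hX => by simp [hX])]
    simp
  | succ t ih =>
    rw [lintegral_srwLaw_succ t fun w => ENNReal.ofReal (V w)]
    calc _ ≤ ∫⁻ X, ENNReal.ofReal r * ENNReal.ofReal (V (X t)) ∂srwLaw nbrs h := by
          refine lintegral_mono fun X => ?_
          simp only [srwKernel_apply]
          rw [PMF.lintegral_ofMultiset_ofReal _ _ hV.nonneg, ← ENNReal.ofReal_mul hV.rate_nonneg]
          refine ENNReal.ofReal_le_ofReal ?_
          have hc : (0 : ℝ) < Multiset.card (nbrs (X t)) := by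
            exact_mod_cast Multiset.card_pos.2 (h _)
          rw [div_le_iff₀ hc]
          linarith [hV.sum_le (X t)]
      _ = ENNReal.ofReal r * ∫⁻ X, ENNReal.ofReal (V (X t)) ∂srwLaw nbrs h :=
          lintegral_const_mul' _ _ ENNReal.ofReal_ne_top
      _ ≤ ENNReal.ofReal r * ENNReal.ofReal (r ^ t * V []) := by gcongr
      _ = _ := by
          rw [← ENNReal.ofReal_mul hV.rate_nonneg]
          congr 1
          ring

theorem IsLyapunov.ae_summable (hV : IsLyapunov nbrs V r) :
    ∀ᵐ X ∂srwLaw nbrs h, Summable fun t => V (X t) := by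
  have hm (t : ℕ) : Measurable fun X : ℕ → BitString => ENNReal.ofReal (V (X t)) :=
    (measurable_of_countable fun w => ENNReal.ofReal (V w)).comp (measurable_pi_apply t)
  have h1 : ∫⁻ X, ∑' t, ENNReal.ofReal (V (X t)) ∂srwLaw nbrs h ≠ ⊤ := by
    rw [lintegral_tsum fun t => (hm t).aemeasurable]
    refine ne_top_of_le_ne_top ?_ (ENNReal.tsum_le_tsum fun t => hV.lintegral_le t)
    have hs : Summable fun t : ℕ => r ^ t * V [] :=
      (summable_geometric_of_lt_one hV.rate_nonneg hV.rate_lt_one).mul_right _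
    rw [← ENNReal.ofReal_tsum_of_nonneg
      (fun t => mul_nonneg (pow_nonneg hV.rate_nonneg t) (hV.nonneg _)) hs]
    exact ENNReal.ofReal_ne_top
  filter_upwards [ae_lt_top (Measurable.tsum hm) h1] with X hX
  have := ENNReal.summable_toReal hX.ne
  simpa only [ENNReal.toReal_ofReal (hV.nonneg _)] using this

/-- Each step moves the position by at most `2 * V`, and the sum of `V` along the walk has finite
mean. -/
theorem IsLyapunov.ae_exists_tendsto (hV : IsLyapunov nbrs V r) :
    ∀ᵐ X ∂srwLaw nbrs h, ∃ z : UnitAddCircle,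
      Tendsto (fun t => circlePosition (X t)) atTop (𝓝 z) := by
  filter_upwards [hV.ae_summable, ae_mem_nbrs] with X hX hn
  refine cauchySeq_tendsto_of_complete (cauchySeq_of_dist_le_of_summable _ (fun t => ?_)
    (hX.mul_left 2))
  exact hV.dist_le _ _ (hn t)

/-- Lets a character be replaced, without changing the limit, by a nearby function that behaves
better under averaging. -/
theorem IsLyapunov.tendsto_integral_zero (hV : IsLyapunov nbrs V r) {f : BitString → ℂ} {C : ℝ}
    (hC : 0 ≤ C) (hf : ∀ w, ‖f w‖ ≤ C * V w) :
    Tendsto (fun t => ∫ X, f (X t) ∂srwLaw nbrs h) atTop (𝓝 0) := by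
  have hb (t : ℕ) : ‖∫ X, f (X t) ∂srwLaw nbrs h‖ ≤ C * (r ^ t * V []) := by
    have h0 : 0 ≤ r ^ t * V [] := mul_nonneg (pow_nonneg hV.rate_nonneg t) (hV.nonneg _)
    refine (norm_integral_le_lintegral_norm _).trans
      (ENNReal.toReal_le_of_le_ofReal (mul_nonneg hC h0) ?_)
    calc _ ≤ ∫⁻ X, ENNReal.ofReal C * ENNReal.ofReal (V (X t)) ∂srwLaw nbrs h := by
          refine lintegral_mono fun X => ?_
          rw [← ENNReal.ofReal_mul hC]
          exact ENNReal.ofReal_le_ofReal (hf _)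
      _ = ENNReal.ofReal C * ∫⁻ X, ENNReal.ofReal (V (X t)) ∂srwLaw nbrs h :=
          lintegral_const_mul' _ _ ENNReal.ofReal_ne_top
      _ ≤ ENNReal.ofReal C * ENNReal.ofReal (r ^ t * V []) := by
          gcongr
          exact hV.lintegral_le t
      _ = _ := by rw [← ENNReal.ofReal_mul hC]
  refine squeeze_zero_norm hb ?_
  have := ((tendsto_pow_atTop_nhds_zero_of_lt_one hV.rate_nonneg hV.rate_lt_one).mul_const
    (V [])).const_mul C
  simpa using this

/-- The limit of the horizontal positions, as a point of the circle. -/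
noncomputable def circleLimit (X : ℕ → BitString) : UnitAddCircle :=
  limUnder atTop fun t => circlePosition (X t)

theorem measurable_circleLimit : Measurable circleLimit := by
  have (t : ℕ) : StronglyMeasurable fun X : ℕ → BitString => circlePosition (X t) :=
    ((measurable_of_countable circlePosition).comp (measurable_pi_apply t)).stronglyMeasurable
  exact (StronglyMeasurable.limUnder this).measurable

theorem IsLyapunov.tendsto_integral_fourier (hV : IsLyapunov nbrs V r) (k : ℤ) :
    Tendsto (fun t => ∫ X, fourier k (circlePosition (X t)) ∂srwLaw nbrs h) atTop
      (𝓝 (∫ z, fourier k z ∂(srwLaw nbrs h).map circleLimit)) := by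
  rw [integral_map measurable_circleLimit.aemeasurable
    (fourier k).continuous.measurable.aestronglyMeasurable]
  refine tendsto_integral_of_dominated_convergence (fun _ => 1) (fun t => ?_)
    (integrable_const 1) (fun t => Eventually.of_forall fun X => ?_) ?_
  · exact ((measurable_of_countable fun w => fourier k (circlePosition w)).comp
      (measurable_pi_apply t)).aestronglyMeasurable
  · exact (Circle.norm_coe _).le
  · filter_upwards [hV.ae_exists_tendsto] with X hX
    exact ((fourier k).continuous.tendsto _).comp (tendsto_nhds_limUnder hX)

end Walk

/-! ### Positions on the circle -/

section Position

namespace BitString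

theorem length_pred (w : BitString) : (pred w).length = w.length := by
  conv_rhs => rw [← succ_pred w, length_succ]

end BitString

theorem circlePosition_eq (w : BitString) :
    circlePosition w = (((BitString.val w : ℝ) / 2 ^ w.length : ℝ) : UnitAddCircle) := rfl

theorem circlePosition_succ (w : BitString) :
    circlePosition (BitString.succ w)
      = circlePosition w + ((1 / 2 ^ w.length : ℝ) : UnitAddCircle) := by
  rw [circlePosition_eq, circlePosition_eq, BitString.length_succ, BitString.val_succ,
    ← AddCircle.coe_add]
  have h := Nat.mod_add_div (BitString.val w + 1) (2 ^ w.length)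
  have h' : ((BitString.val w + 1 : ℕ) : ℝ)
      = ((BitString.val w + 1) % 2 ^ w.length : ℕ)
        + 2 ^ w.length * ((BitString.val w + 1) / 2 ^ w.length : ℕ) := by
    exact_mod_cast h.symm
  have e : (BitString.val w : ℝ) / 2 ^ w.length + 1 / 2 ^ w.length
      = (((BitString.val w + 1) % 2 ^ w.length : ℕ) : ℝ) / 2 ^ w.length
        + ((BitString.val w + 1) / 2 ^ w.length : ℕ) := by
    rw [← add_div, ← Nat.cast_add_one, h']
    field_simp
  rw [e, AddCircle.coe_add]
  have : (((((BitString.val w + 1) / 2 ^ w.length : ℕ) : ℝ)) : UnitAddCircle) = 0 := by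
    rw [AddCircle.coe_eq_zero_iff]
    exact ⟨((BitString.val w + 1) / 2 ^ w.length : ℕ), by rw [zsmul_one, Int.cast_natCast]⟩
  rw [this, add_zero]

theorem circlePosition_false (w : BitString) :
    circlePosition (false :: w) = circlePosition w := by
  rw [circlePosition_eq, circlePosition_eq]
  congr 1
  simp only [BitString.val, List.length_cons, Bool.toNat_false, add_zero]
  push_cast
  rw [pow_succ]
  field_simp

theorem circlePosition_true (w : BitString) :
    circlePosition (true :: w)
      = circlePosition w + ((1 / 2 ^ (w.length + 1) : ℝ) : UnitAddCircle) := by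
  rw [circlePosition_eq, circlePosition_eq, ← AddCircle.coe_add]
  congr 1
  simp only [BitString.val, List.length_cons, Bool.toNat_true]
  push_cast
  rw [pow_succ]
  field_simp

theorem dist_circlePosition_of_eq_add {w w' : BitString} {x : ℝ} (hx : 0 ≤ x)
    (h : circlePosition w' = circlePosition w + (x : UnitAddCircle)) :
    dist (circlePosition w) (circlePosition w') ≤ x := by
  rw [h, dist_self_add_right]
  exact QuotientAddGroup.norm_mk_le_norm.trans (Real.norm_of_nonneg hx).le

theorem dist_circlePosition_succ_le (w : BitString) :
    dist (circlePosition w) (circlePosition (BitString.succ w)) ≤ 1 / 2 ^ w.length :=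
  dist_circlePosition_of_eq_add (by positivity) (circlePosition_succ w)

theorem dist_circlePosition_pred_le (w : BitString) :
    dist (circlePosition w) (circlePosition (BitString.pred w)) ≤ 1 / 2 ^ w.length := by
  have := dist_circlePosition_succ_le (BitString.pred w)
  rwa [BitString.succ_pred, BitString.length_pred, dist_comm] at this

theorem dist_circlePosition_cons_le (b : Bool) (w : BitString) :
    dist (circlePosition w) (circlePosition (b :: w)) ≤ 1 / 2 ^ (w.length + 1) := by
  cases b
  · rw [circlePosition_false, dist_self]
    positivity
  · exact dist_circlePosition_of_eq_add (by positivity) (circlePosition_true w)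

theorem one_div_two_pow_le_pow (n : ℕ) : (1 : ℝ) / 2 ^ n ≤ (3 / 4) ^ n := by
  rw [← one_div_pow]
  exact pow_le_pow_left₀ (by norm_num) (by norm_num) _

/-- Depth `n + 1` corresponds to level `n`, so a full turn is two units of level zero and the
frequency is `π * k` instead of `2 * π * k`. -/
theorem fourier_circlePosition (k : ℤ) (w : BitString) (n : ℕ) (hn : w.length = n + 1) :
    fourier k (circlePosition w) = latticeWave (Real.pi * k) (BitString.val w, n) := by
  rw [circlePosition_eq, fourier_coe_apply, latticeWave, hn]
  congr 1
  push_cast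
  rw [pow_succ]
  field_simp

end Position

/-! ### Fourier coefficients of the harmonic measure -/

section Primal

/-- A Lyapunov function for the walk on the wrapped dyadic lattice graph. -/
noncomputable def primalWeight (w : BitString) : ℝ :=
  (3 / 4) ^ w.length * (if w.head? = some true then 15 / 16 else 1)

theorem primalWeight_le (w : BitString) : primalWeight w ≤ (3 / 4) ^ w.length := by
  unfold primalWeight
  split_ifs
  · exact mul_le_of_le_one_right (by positivity) (by norm_num)
  · rw [mul_one]

theorem le_primalWeight (w : BitString) : (3 / 4) ^ w.length * (15 / 16) ≤ primalWeight w := by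
  unfold primalWeight
  gcongr
  split_ifs <;> norm_num

/-- The rate is dictated by strings ending in `0`, where `15/16 + 15/16 + 3/4 + 4/3 = 4 * (95/96)`.
-/
theorem primal_isLyapunov : IsLyapunov primalNeighbors primalWeight (95 / 96) where
  nonneg w := le_trans (by positivity) (le_primalWeight w)
  rate_nonneg := by norm_num
  rate_lt_one := by norm_num
  sum_le w := by
    rcases w with _ | ⟨_ | _, w⟩
    · simp [primalNeighbors, primalWeight]
      norm_num
    · have h := primalWeight_le w
      simp only [primalNeighbors, Multiset.insert_eq_cons, Multiset.map_cons,
        Multiset.map_singleton, Multiset.sum_cons, Multiset.sum_singleton, Multiset.card_cons,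
        Multiset.card_singleton]
      have hq : (0 : ℝ) < (3 / 4) ^ w.length := by positivity
      refine (add_le_add_right (add_le_add_right (add_le_add_right h _) _) _).trans ?_
      simp only [primalWeight, BitString.succ, BitString.pred, List.length_cons,
        BitString.length_pred, List.head?_cons, pow_succ]
      norm_num
      linarith
    · simp only [primalNeighbors, Multiset.insert_eq_cons, Multiset.map_cons,
        Multiset.map_singleton, Multiset.sum_cons, Multiset.sum_singleton, Multiset.card_cons,
        Multiset.card_singleton]
      have hq : (0 : ℝ) < (3 / 4) ^ w.length := by positivity
      simp only [primalWeight, BitString.succ, BitString.pred, List.length_cons,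
        BitString.length_succ, List.head?_cons, pow_succ]
      norm_num
      linarith
  dist_le w w' hw := by
    have h1 := one_div_two_pow_le_pow w.length
    have h2 := le_primalWeight w
    have h3 : (0 : ℝ) < (3 / 4) ^ w.length := by positivity
    have hs := dist_circlePosition_succ_le w
    have hp := dist_circlePosition_pred_le w
    have h0 : dist (circlePosition w) (circlePosition (false :: w)) = 0 := by
      rw [circlePosition_false, dist_self]
    rcases w with _ | ⟨_ | _, w⟩ <;>
      simp only [primalNeighbors, Multiset.insert_eq_cons, Multiset.mem_cons,
        Multiset.mem_singleton] at hw
    · rcases hw with rfl | rfl | rfl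
      · simpa using by linarith
      · simpa using by linarith
      · linarith
    · rcases hw with rfl | rfl | rfl | rfl
      · linarith
      · linarith
      · linarith
      · rw [circlePosition_false, dist_self]
        linarith
    · rcases hw with rfl | rfl | rfl
      · linarith
      · linarith
      · linarith

/-- The function `escapeWave` on the wrapped graph below the root, extended by zero. -/
noncomputable def wrappedWave (k : ℤ) : BitString → ℂ
  | [] => 0
  | b :: w => escapeWave (Real.pi * k) (BitString.val (b :: w), w.length)

/-- Translation by two units of level zero multiplies by a power of `exp (2 * π * I * k) = 1`, so
the escape function descends to the wrapped graph. -/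
theorem escapeWave_periodic (k : ℤ) {x y : ℤ} {n : ℕ} (h : x ≡ y [ZMOD 2 ^ (n + 1)]) :
    escapeWave (Real.pi * k) (x, n) = escapeWave (Real.pi * k) (y, n) := by
  obtain ⟨a, ha⟩ := h.symm.dvd
  have h1 := congrFun (escapeWave_shift (Real.pi * k) a) (y, n)
  have h2 : y + 2 ^ n * (2 * a) = x := by
    rw [pow_succ] at ha
    linarith
  have h3 : Complex.exp ((Real.pi * k * (2 * a : ℤ) : ℝ) * Complex.I) = 1 := by
    rw [Complex.exp_eq_one_iff]
    refine ⟨k * a, ?_⟩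
    push_cast
    ring
  rw [Pi.smul_apply, h3, one_smul] at h1
  simp only [latticeShift, h2] at h1
  exact h1

theorem val_succ_modEq (w : BitString) :
    (BitString.val (BitString.succ w) : ℤ) ≡ BitString.val w + 1 [ZMOD 2 ^ w.length] := by
  rw [BitString.val_succ]
  push_cast
  exact Int.mod_modEq _ _

theorem val_pred_modEq (w : BitString) :
    (BitString.val (BitString.pred w) : ℤ) ≡ BitString.val w - 1 [ZMOD 2 ^ w.length] := by
  have h := val_succ_modEq (BitString.pred w)
  rw [BitString.succ_pred, BitString.length_pred] at h
  simpa using (h.sub_right 1).symm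

theorem wrappedWave_eq (k : ℤ) {w : BitString} {n : ℕ} (hn : w.length = n + 1) {x : ℤ}
    (hx : (BitString.val w : ℤ) ≡ x [ZMOD 2 ^ w.length]) :
    wrappedWave k w = escapeWave (Real.pi * k) (x, n) := by
  rcases w with _ | ⟨b, w⟩
  · simp at hn
  · have : w.length = n := by simpa using hn
    subst this
    exact escapeWave_periodic k hx

/-- The value zero at the root encodes killing, so the function is harmonic elsewhere. At the root
both loops contribute zero, and the third edge leads to `[false]`, the origin of the half lattice.
-/
theorem nbrAverage_wrappedWave (k : ℤ) (w : BitString) :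
    nbrAverage primalNeighbors (wrappedWave k) w
      = wrappedWave k w + escapeChar (Real.pi * k) / 3 * (if w = [] then 1 else 0) := by
  have hs (b : Bool) (w : BitString) := wrappedWave_eq k (w := BitString.succ (b :: w))
    (n := w.length) (by simp [BitString.length_succ]) (x := BitString.val (b :: w) + 1)
    (by rw [BitString.length_succ]; exact val_succ_modEq (b :: w))
  have hp (b : Bool) (w : BitString) := wrappedWave_eq k (w := BitString.pred (b :: w))
    (n := w.length) (by simp [BitString.length_pred]) (x := BitString.val (b :: w) - 1)
    (by rw [BitString.length_pred]; exact val_pred_modEq (b :: w))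
  have hd (b : Bool) (w : BitString) := wrappedWave_eq k (w := false :: b :: w)
    (n := w.length + 1) rfl (x := 2 * BitString.val (b :: w)) (by simp [BitString.val])
  rcases w with _ | ⟨b, w⟩
  · simp [nbrAverage, primalNeighbors, wrappedWave, BitString.val, escapeChar]
  have hk := congrFun (killedStep_escapeWave (Real.pi * k)) (BitString.val (b :: w), w.length)
  rw [killedStep_apply] at hk
  simp only [latticeSum] at hk
  cases b
  · have heven : Even (BitString.val (false :: w) : ℤ) := by simp [BitString.val]
    have hu : latticeUp (escapeWave (Real.pi * k)) (BitString.val (false :: w), w.length)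
        = wrappedWave k w := by
      rcases w with _ | ⟨c, w⟩
      · rfl
      · simp only [List.length_cons, latticeUp, heven, if_true, wrappedWave]
        congr 2
        simp [BitString.val]
    have hdeg : latticeDeg (BitString.val (false :: w) : ℤ) = 4 := by simp [latticeDeg, heven]
    rw [hu, ← hs, ← hp, ← hd, hdeg] at hk
    simp only [nbrAverage, primalNeighbors, Multiset.insert_eq_cons, Multiset.map_cons,
      Multiset.map_singleton, Multiset.sum_cons, Multiset.sum_singleton, Multiset.card_cons,
      Multiset.card_singleton]
    conv_rhs => rw [wrappedWave, ← hk]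
    simp
    ring
  · have hodd : ¬ Even (BitString.val (true :: w) : ℤ) := by simp [BitString.val]
    have hu : latticeUp (escapeWave (Real.pi * k)) (BitString.val (true :: w), w.length) = 0 := by
      rcases w with _ | ⟨c, w⟩
      · rfl
      · simp only [List.length_cons, latticeUp, hodd, if_false]
    have hdeg : latticeDeg (BitString.val (true :: w) : ℤ) = 3 := by simp [latticeDeg, hodd]
    rw [hu, ← hs, ← hp, ← hd, hdeg] at hk
    simp only [nbrAverage, primalNeighbors, Multiset.insert_eq_cons, Multiset.map_cons,
      Multiset.map_singleton, Multiset.sum_cons, Multiset.sum_singleton, Multiset.card_cons,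
      Multiset.card_singleton]
    conv_rhs => rw [wrappedWave, ← hk]
    simp
    ring

theorem exists_norm_wrappedWave_sub_le (k : ℤ) : ∃ C : ℝ, 0 ≤ C ∧
    ∀ w, ‖fourier k (circlePosition w) - wrappedWave k w‖ ≤ C * primalWeight w := by
  obtain ⟨C, hC0, hC⟩ := exists_norm_escapeWave_sub_le (Real.pi * k)
  refine ⟨140 * C + 1, by positivity, fun w => ?_⟩
  rcases w with _ | ⟨b, w⟩
  · have : ‖fourier k (circlePosition [])‖ = 1 := Circle.norm_coe _
    have h1 : primalWeight [] = 1 := by simp [primalWeight]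
    rw [wrappedWave, sub_zero, this, h1]
    linarith
  · rw [fourier_circlePosition k (b :: w) w.length rfl, norm_sub_rev, wrappedWave]
    refine (hC _).trans ?_
    have h1 := latticeWeight_le (BitString.val (b :: w), w.length)
    have h2 := le_primalWeight (b :: w)
    have h3 : |((BitString.val (b :: w) : ℤ) : ℝ)| / 2 ^ w.length ≤ 2 := by
      rw [div_le_iff₀ (by positivity), abs_of_nonneg (by positivity)]
      have := (BitString.val_lt (b :: w)).le
      rw [List.length_cons, pow_succ, mul_comm] at this
      exact_mod_cast this
    simp only [List.length_cons, pow_succ] at h1 h2 ⊢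
    have hq : (0 : ℝ) < (3 / 4) ^ w.length := by positivity
    -- The ratio is at most `98 * (4/3) * (16/15) < 140`.
    have h4 : latticeWeight (BitString.val (b :: w), w.length) ≤ 140 * primalWeight (b :: w) := by
      nlinarith [mul_le_mul_of_nonneg_left h3 hq.le]
    have h5 : 0 ≤ primalWeight (b :: w) := by linarith
    nlinarith [mul_le_mul_of_nonneg_left h4 hC0]

theorem exists_norm_wrappedWave_le (k : ℤ) : ∃ B : ℝ, ∀ w, ‖wrappedWave k w‖ ≤ B := by
  obtain ⟨C, hC0, hC⟩ := exists_norm_wrappedWave_sub_le k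
  refine ⟨1 + C, fun w => ?_⟩
  have h1 : ‖fourier k (circlePosition w)‖ = 1 := Circle.norm_coe _
  have h2 : primalWeight w ≤ 1 := (primalWeight_le w).trans (pow_le_one₀ (by norm_num) (by norm_num))
  have h3 := norm_sub_norm_le (wrappedWave k w) (fourier k (circlePosition w))
  rw [norm_sub_rev] at h3
  have h4 := hC w
  have := mul_le_mul_of_nonneg_left h2 hC0
  linarith

/-- The expected number of visits to the root before time `n`. -/
noncomputable def rootVisits (n : ℕ) : ℂ :=
  ∑ t ∈ Finset.range n, ∫ X, (if X t = [] then 1 else 0 : ℂ) ∂primalWalk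

theorem integral_wrappedWave (k : ℤ) (n : ℕ) :
    ∫ X, wrappedWave k (X n) ∂primalWalk = escapeChar (Real.pi * k) / 3 * rootVisits n := by
  obtain ⟨B, hB⟩ := exists_norm_wrappedWave_le k
  induction n with
  | zero =>
    rw [primalWalk, integral_srwLaw_zero]
    simp [wrappedWave, rootVisits]
  | succ n ih =>
    have hi : ∀ w : BitString, ‖(if w = [] then 1 else 0 : ℂ)‖ ≤ 1 := by
      intro w
      split_ifs <;> simp
    rw [rootVisits, Finset.sum_range_succ, ← rootVisits, mul_add, ← ih, primalWalk,
      integral_srwLaw_succ hB]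
    simp only [nbrAverage_wrappedWave]
    rw [integral_add (integrable_srwLaw hB n) ((integrable_srwLaw hi n).const_mul _),
      integral_const_mul]

theorem tendsto_rootVisits (k : ℤ) :
    Tendsto (fun n => escapeChar (Real.pi * k) / 3 * rootVisits n) atTop
      (𝓝 (∫ z, fourier k z ∂primalWalk.map circleLimit)) := by
  obtain ⟨C, hC0, hC⟩ := exists_norm_wrappedWave_sub_le k
  obtain ⟨B, hB⟩ := exists_norm_wrappedWave_le k
  have h1 := primal_isLyapunov.tendsto_integral_fourier (h := primalNeighbors_ne_zero) k
  have h2 := primal_isLyapunov.tendsto_integral_zero (h := primalNeighbors_ne_zero) hC0 hC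
  have h3 := h1.sub h2
  rw [sub_zero] at h3
  refine h3.congr fun n => ?_
  have hf : ∀ w, ‖fourier k (circlePosition w)‖ ≤ 1 := fun w => (Circle.norm_coe _).le
  rw [← integral_wrappedWave, integral_sub (integrable_srwLaw hf n) (integrable_srwLaw hB n),
    sub_sub_cancel]
  rfl

/-- The expected number of root visits enters every coefficient alike. The coefficient for `k = 0`
is `1`, which shows `escapeChar 0 ≠ 0` and fixes the common factor. -/
theorem integral_fourier_primal : escapeChar 0 ≠ 0 ∧
    ∀ k : ℤ, ∫ z, fourier k z ∂primalWalk.map circleLimit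
      = escapeChar (Real.pi * k) / escapeChar 0 := by
  have : IsProbabilityMeasure (primalWalk.map circleLimit) := by
    have : IsProbabilityMeasure primalWalk := by
      unfold primalWalk
      infer_instance
    exact Measure.isProbabilityMeasure_map measurable_circleLimit.aemeasurable
  have h0 := tendsto_rootVisits 0
  have e0 : ∫ z : UnitAddCircle, fourier 0 z ∂primalWalk.map circleLimit = 1 := by simp
  rw [e0, Int.cast_zero, mul_zero] at h0
  have hA : escapeChar 0 ≠ 0 := by
    intro hA
    rw [hA] at h0
    simp only [zero_div, zero_mul] at h0
    exact one_ne_zero (tendsto_nhds_unique h0 tendsto_const_nhds)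
  refine ⟨hA, fun k => ?_⟩
  refine tendsto_nhds_unique (tendsto_rootVisits k) ?_
  have h1 := h0.const_mul (escapeChar (Real.pi * k) / escapeChar 0)
  rw [mul_one] at h1
  refine h1.congr fun n => ?_
  field_simp

end Primal

/-! ### The dual harmonic measure is Lebesgue measure -/

section Dual

/-- The sum of a function over the strings of a given length. -/
def levelSum : ℕ → (BitString → ℂ) → ℂ
  | 0, f => f []
  | n + 1, f => levelSum n fun w => f (false :: w) + f (true :: w)

theorem levelSum_congr {n : ℕ} {f g : BitString → ℂ} (h : ∀ w, w.length = n → f w = g w) :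
    levelSum n f = levelSum n g := by
  induction n generalizing f g with
  | zero => exact h [] rfl
  | succ n ih =>
    refine ih fun w hw => ?_
    rw [h _ (by simp [hw]), h _ (by simp [hw])]

theorem levelSum_add (n : ℕ) (f g : BitString → ℂ) :
    levelSum n (fun w => f w + g w) = levelSum n f + levelSum n g := by
  induction n generalizing f g with
  | zero => rfl
  | succ n ih =>
    simp only [levelSum]
    rw [← ih]
    exact levelSum_congr fun w _ => by ring

theorem levelSum_const_mul (n : ℕ) (a : ℂ) (f : BitString → ℂ) :
    levelSum n (fun w => a * f w) = a * levelSum n f := by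
  induction n generalizing f with
  | zero => rfl
  | succ n ih =>
    simp only [levelSum]
    rw [← ih]
    exact levelSum_congr fun w _ => by ring

theorem levelSum_zero (n : ℕ) : levelSum n (fun _ => 0) = 0 := by
  simpa using levelSum_const_mul n 0 fun _ => 0

theorem levelSum_succ (n : ℕ) (f : BitString → ℂ) :
    levelSum n (fun w => f (BitString.succ w)) = levelSum n f := by
  induction n generalizing f with
  | zero => rfl
  | succ n ih =>
    simp only [levelSum, BitString.succ]
    rw [levelSum_add, levelSum_add, ih fun w => f (false :: w)]
    ring

theorem levelSum_pred (n : ℕ) (f : BitString → ℂ) :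
    levelSum n (fun w => f (BitString.pred w)) = levelSum n f := by
  rw [← levelSum_succ n fun w => f (BitString.pred w)]
  simp only [BitString.pred_succ]

/-- Horizontal moves permute a level, the children of a level exhaust the next one, and each parent
is counted twice. Since the degree is constant on a level, zero sums persist. -/
theorem levelSum_nbrAverage_dual {f : BitString → ℂ} (hf : ∀ n, levelSum n f = 0) (n : ℕ) :
    levelSum n (nbrAverage dualNeighbors f) = 0 := by
  rcases n with _ | n
  · have h0 : f [] = 0 := hf 0
    have h1 : f [false] + f [true] = 0 := hf 1
    simp [levelSum, nbrAverage, dualNeighbors, h0, h1]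
  · have e : levelSum (n + 1) (nbrAverage dualNeighbors f) = levelSum (n + 1) fun w =>
        5⁻¹ * (f (BitString.succ w) + (f (BitString.pred w)
          + ((f (false :: w) + f (true :: w)) + f w.tail))) := by
      refine levelSum_congr fun w hw => ?_
      rcases w with _ | ⟨b, w⟩
      · simp at hw
      · simp [nbrAverage, dualNeighbors]
        ring
    have h3 : levelSum (n + 1) (fun w => f (false :: w) + f (true :: w)) = 0 := hf (n + 2)
    have h4 : levelSum (n + 1) (fun w => f w.tail) = 0 := by
      simp only [levelSum, List.tail_cons]
      rw [levelSum_add]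
      simp [hf n]
    rw [e, levelSum_const_mul, levelSum_add, levelSum_succ, levelSum_add, levelSum_pred,
      levelSum_add (n + 1) (fun w => f (false :: w) + f (true :: w)), h3, h4, hf]
    simp

theorem dual_isLyapunov : IsLyapunov dualNeighbors (fun w => (3 / 4) ^ w.length) (95 / 96) where
  nonneg w := by positivity
  rate_nonneg := by norm_num
  rate_lt_one := by norm_num
  sum_le w := by
    rcases w with _ | ⟨b, w⟩
    · simp [dualNeighbors]
      norm_num
    · have hq : (0 : ℝ) < (3 / 4) ^ w.length := by positivity
      simp only [dualNeighbors, Multiset.insert_eq_cons, Multiset.map_cons,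
        Multiset.map_singleton, Multiset.sum_cons, Multiset.sum_singleton, Multiset.card_cons,
        Multiset.card_singleton, List.length_cons, BitString.length_pred, BitString.length_succ,
        pow_succ]
      norm_num
      linarith
  dist_le w w' hw := by
    have h1 := one_div_two_pow_le_pow w.length
    have h3 : (0 : ℝ) < (3 / 4) ^ w.length := by positivity
    have hs := dist_circlePosition_succ_le w
    have hp := dist_circlePosition_pred_le w
    have hd (b : Bool) : dist (circlePosition w) (circlePosition (b :: w)) ≤ 1 / 2 ^ w.length :=
      (dist_circlePosition_cons_le b w).trans (by gcongr <;> norm_num)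
    have h00 : dist (circlePosition []) (circlePosition []) = 0 := dist_self _
    have hf := hd false
    have ht := hd true
    rcases w with _ | ⟨b, w⟩ <;>
      simp only [dualNeighbors, Multiset.insert_eq_cons, Multiset.mem_cons,
        Multiset.mem_singleton] at hw
    · rcases hw with rfl | rfl | rfl | rfl <;> linarith
    · rcases hw with rfl | rfl | rfl | rfl | rfl
      · linarith
      · linarith
      · linarith
      · linarith
      · have := dist_circlePosition_cons_le b w'
        rw [dist_comm] at this
        rw [List.length_cons] at h1 h3 ⊢
        linarith

theorem levelSum_fourier_succ (k : ℤ) (n : ℕ) :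
    levelSum (n + 1) (fun w => fourier k (circlePosition w))
      = (1 + fourier k ((1 / 2 ^ (n + 1) : ℝ) : UnitAddCircle))
        * levelSum n fun w => fourier k (circlePosition w) := by
  rw [← levelSum_const_mul]
  change levelSum n (fun w => fourier k (circlePosition (false :: w))
    + fourier k (circlePosition (true :: w))) = _
  refine levelSum_congr fun w hw => ?_
  rw [circlePosition_false, circlePosition_true, hw, fourier_apply, fourier_apply, fourier_apply,
    smul_add, AddCircle.toCircle_add, Circle.coe_mul]
  ring

/-- If `2 ^ v` exactly divides `k`, the factor `1 + exp (2 * π * I * k / 2 ^ (v + 1))` is zero, and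
it divides the sum on every deeper level. -/
theorem exists_levelSum_fourier_eq_zero {k : ℤ} (hk : k ≠ 0) :
    ∃ N, ∀ n, N ≤ n → levelSum n (fun w => fourier k (circlePosition w)) = 0 := by
  obtain ⟨v, m, hm, rfl⟩ : ∃ (v : ℕ) (m : ℤ), Odd m ∧ k = 2 ^ v * m := by
    obtain ⟨m, h1, h2⟩ := (Int.finiteMultiplicity_iff.2 ⟨by decide, hk⟩ :
      FiniteMultiplicity (2 : ℤ) k).exists_eq_pow_mul_and_not_dvd
    exact ⟨_, m, Int.not_even_iff_odd.1 fun h => h2 h.two_dvd, h1⟩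
  refine ⟨v + 1, fun n hn => ?_⟩
  induction n, hn using Nat.le_induction with
  | base =>
    rw [levelSum_fourier_succ]
    refine mul_eq_zero_of_left ?_ _
    obtain ⟨a, rfl⟩ := hm
    rw [fourier_coe_apply]
    have : 2 * Real.pi * Complex.I * ((2 ^ v * (2 * a + 1) : ℤ) : ℂ)
        * ((1 / 2 ^ (v + 1) : ℝ) : ℂ) / (1 : ℝ)
        = Real.pi * Complex.I + a * (2 * Real.pi * Complex.I) := by
      push_cast
      rw [pow_succ]
      field_simp
      ring
    rw [this, Complex.exp_add, Complex.exp_pi_mul_I, Complex.exp_int_mul_two_pi_mul_I]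
    simp
  | succ n _ ih => rw [levelSum_fourier_succ, ih, mul_zero]

theorem integral_dual_eq_zero {f : BitString → ℂ} {B : ℝ} (hB : ∀ w, ‖f w‖ ≤ B)
    (hf : ∀ n, levelSum n f = 0) (t : ℕ) : ∫ X, f (X t) ∂dualWalk = 0 := by
  have hB0 : 0 ≤ B := (norm_nonneg _).trans (hB [])
  induction t generalizing f with
  | zero =>
    rw [dualWalk, integral_srwLaw_zero]
    exact hf 0
  | succ t ih =>
    rw [dualWalk, integral_srwLaw_succ hB]
    refine ih (fun w => ?_) (levelSum_nbrAverage_dual hf)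
    have hc : (0 : ℝ) < Multiset.card (dualNeighbors w) := by
      exact_mod_cast Multiset.card_pos.2 (dualNeighbors_ne_zero w)
    rw [nbrAverage, norm_div, Complex.norm_natCast, div_le_iff₀ hc]
    refine (norm_multiset_sum_le _).trans ?_
    rw [Multiset.map_map, mul_comm, ← nsmul_eq_mul, ← Multiset.card_map (norm ∘ f)]
    refine Multiset.sum_le_card_nsmul _ _ fun x hx => ?_
    obtain ⟨y, -, rfl⟩ := Multiset.mem_map.1 hx
    exact hB y

theorem integral_fourier_dual {k : ℤ} (hk : k ≠ 0) :
    ∫ z, fourier k z ∂dualWalk.map circleLimit = 0 := by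
  obtain ⟨N, hN⟩ := exists_levelSum_fourier_eq_zero hk
  -- Truncation to deep levels makes every level sum zero. What is discarded lives at depths below
  -- `N`, where `(4/3) ^ N * (3/4) ^ depth` is at least `1`.
  set f : BitString → ℂ := fun w => if N ≤ w.length then fourier k (circlePosition w) else 0
    with hf
  have hF (w) : ‖fourier k (circlePosition w)‖ = 1 := Circle.norm_coe _
  have hfB (w) : ‖f w‖ ≤ 1 := by
    simp only [hf]
    split_ifs
    · exact (hF w).le
    · simp
  have hf0 (n) : levelSum n f = 0 := by
    by_cases hn : N ≤ n
    · rw [← hN n hn]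
      exact levelSum_congr fun w hw => by simp [hf, hw, hn]
    · rw [← levelSum_zero n]
      exact levelSum_congr fun w hw => by simp [hf, hw, hn]
  have h1 := dual_isLyapunov.tendsto_integral_fourier (h := dualNeighbors_ne_zero) k
  have h2 := dual_isLyapunov.tendsto_integral_zero (h := dualNeighbors_ne_zero)
    (f := fun w => fourier k (circlePosition w) - f w) (C := (4 / 3) ^ N) (by positivity)
    (fun w => by
      simp only [hf]
      split_ifs with hw
      · rw [sub_self, norm_zero]
        positivity
      · rw [sub_zero, hF]
        push Not at hw
        calc (1 : ℝ) = (4 / 3) ^ N * (3 / 4) ^ N := by rw [← mul_pow]; norm_num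
          _ ≤ (4 / 3) ^ N * (3 / 4) ^ w.length := by
            gcongr ?_ * ?_
            exact pow_le_pow_of_le_one (by norm_num) (by norm_num) hw.le)
  refine tendsto_nhds_unique h1 (h2.congr fun t => ?_)
  rw [integral_sub (integrable_srwLaw (fun w => (hF w).le) t) (integrable_srwLaw hfB t)]
  have := integral_dual_eq_zero hfB hf0 t
  rw [dualWalk] at this
  rw [this, sub_zero]

end Dual

/-! ### Measures on the circle and the doubling map -/

section Circle

/-- Trigonometric polynomials form a star subalgebra that separates points, hence determine finite
measures. -/
theorem circleMeasure_ext {μ ν : Measure UnitAddCircle} [IsFiniteMeasure μ] [IsFiniteMeasure ν]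
    (h : ∀ k : ℤ, ∫ z, fourier k z ∂μ = ∫ z, fourier k z ∂ν) : μ = ν := by
  refine ext_of_forall_mem_subalgebra_integral_eq_of_polish (𝕜 := ℂ)
    (A := (fourierSubalgebra (T := 1)).comap
      (BoundedContinuousFunction.toContinuousMapStarₐ ℂ)) ?_ ?_
  · intro x y hxy
    obtain ⟨f, ⟨g, hg, rfl⟩, hne⟩ := fourierSubalgebra_separatesPoints (T := 1) hxy
    refine ⟨_, ⟨g, ⟨BoundedContinuousFunction.mkOfCompact g, ?_, ?_⟩, rfl⟩, hne⟩
    · exact hg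
    · ext
      rfl
  · intro g hg
    have hg' : BoundedContinuousFunction.toContinuousMapStarₐ ℂ g
        ∈ Submodule.span ℂ (Set.range (fourier (T := 1))) := by
      rw [← fourierSubalgebra_coe]
      exact hg
    have hint (μ : Measure UnitAddCircle) [IsFiniteMeasure μ] (f : C(UnitAddCircle, ℂ)) :
        Integrable f μ :=
      (BoundedContinuousFunction.mkOfCompact f).integrable μ
    have key : ∀ f ∈ Submodule.span ℂ (Set.range (fourier (T := 1))),
        ∫ z, f z ∂μ = ∫ z, f z ∂ν := by
      intro f hf
      induction hf using Submodule.span_induction with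
      | mem x hx =>
        obtain ⟨k, rfl⟩ := hx
        exact h k
      | zero => simp
      | add x y _ _ hx hy =>
        simp only [ContinuousMap.add_apply]
        rw [integral_add (hint μ x) (hint μ y), integral_add (hint ν x) (hint ν y), hx, hy]
      | smul a x _ hx =>
        simp only [ContinuousMap.smul_apply]
        rw [integral_smul, integral_smul, hx]
    exact key _ hg'

theorem integral_fourier_volume {k : ℤ} (hk : k ≠ 0) :
    ∫ z : UnitAddCircle, fourier k z = 0 := by
  have h1 := integral_add_right_eq_self (μ := (volume : Measure UnitAddCircle))
    (fun z => fourier k z) (((1 : ℝ) / 2 / k : ℝ) : UnitAddCircle)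
  have h2 (z : UnitAddCircle) :
      fourier k (z + (((1 : ℝ) / 2 / k : ℝ) : UnitAddCircle)) = -fourier k z :=
    fourier_add_half_inv_index hk one_pos z
  simp only [h2, integral_neg] at h1
  exact self_eq_neg.1 h1.symm

instance : IsProbabilityMeasure (volume : Measure UnitAddCircle) :=
  ⟨by rw [AddCircle.measure_univ, ENNReal.ofReal_one]⟩

/-- The representative in `[0, 1)` of a point of the circle. -/
noncomputable def circleRep (z : UnitAddCircle) : ℝ := (AddCircle.equivIco (1 : ℝ) 0 z : ℝ)

theorem measurable_circleRep : Measurable circleRep :=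
  measurable_subtype_coe.comp (AddCircle.measurableEquivIco (1 : ℝ) 0).measurable

theorem circleRep_mem (z : UnitAddCircle) : circleRep z ∈ Set.Ico (0 : ℝ) 1 := by
  have := (AddCircle.equivIco (1 : ℝ) 0 z).2
  exact ⟨this.1, this.2.trans_eq (zero_add 1)⟩

theorem circleRep_coe (x : ℝ) : circleRep (x : UnitAddCircle) = Int.fract x := by
  rw [circleRep, AddCircle.coe_equivIco_mk_apply, div_one, mul_one]

theorem coe_circleRep (z : UnitAddCircle) : (circleRep z : UnitAddCircle) = z :=
  AddCircle.coe_equivIco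

theorem digitShift_circleRep (z : UnitAddCircle) :
    digitShift (circleRep z) = circleRep ((2 : ℕ) • z) := by
  conv_rhs => rw [← coe_circleRep z, ← AddCircle.coe_nsmul, circleRep_coe]
  simp [digitShift]

theorem measurable_digitShift : Measurable digitShift :=
  measurable_fract.comp (measurable_const_mul 2)

theorem map_circleRep_volume :
    (volume : Measure UnitAddCircle).map circleRep = volume.restrict (Set.Ico (0 : ℝ) 1) := by
  have h1 := AddCircle.measurePreserving_mk (1 : ℝ) 0
  rw [zero_add, ← restrict_Ico_eq_restrict_Ioc] at h1
  rw [← h1.map_eq, Measure.map_map measurable_circleRep h1.measurable]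
  have h2 : circleRep ∘ ((↑) : ℝ → UnitAddCircle) =ᵐ[volume.restrict (Set.Ico (0 : ℝ) 1)] id := by
    refine (ae_restrict_mem measurableSet_Ico).mono fun x hx => ?_
    rw [Function.comp_apply, circleRep_coe, id, Int.fract_eq_self.2 hx]
  rw [Measure.map_congr h2, Measure.map_id]

theorem ergodic_digitShift_volume : Ergodic digitShift (volume.restrict (Set.Ico (0 : ℝ) 1)) := by
  have hm : MeasurePreserving circleRep (volume : Measure UnitAddCircle)
      (volume.restrict (Set.Ico (0 : ℝ) 1)) := ⟨measurable_circleRep, map_circleRep_volume⟩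
  exact hm.ergodic_of_ergodic_semiconj (AddCircle.ergodic_nsmul one_lt_two) measurable_digitShift
    fun z => (digitShift_circleRep z).symm

theorem map_circleRep_eq_imp {μ ν : Measure UnitAddCircle}
    (h : μ.map circleRep = ν.map circleRep) : μ = ν := by
  have hc : Measurable fun x : ℝ => (x : UnitAddCircle) := AddCircle.measurable_mk'
  have h1 := congrArg (Measure.map fun x : ℝ => (x : UnitAddCircle)) h
  rw [Measure.map_map hc measurable_circleRep, Measure.map_map hc measurable_circleRep] at h1
  have e : (fun x : ℝ => (x : UnitAddCircle)) ∘ circleRep = id := funext coe_circleRep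
  rwa [e, Measure.map_id, Measure.map_id] at h1

end Circle

/-! ### Singularity of ergodic measures, ergodicity of the Bernoulli shift -/

section Ergodic

variable {X : Type*} {m : MeasurableSpace X}

/-- Distinct ergodic probability measures are mutually singular. -/
theorem Ergodic.mutuallySingular {μ ν : Measure X} [IsProbabilityMeasure μ]
    [IsProbabilityMeasure ν] {f : X → X} (hμ : Ergodic f μ) (hν : Ergodic f ν) (h : μ ≠ ν) :
    μ ⟂ₘ ν := by
  -- The singular part of `μ` is invariant and absolutely continuous with respect to `μ`, hence a
  -- multiple of `μ`. If `c = 0`, then `μ` is absolutely continuous with respect to the ergodic `ν`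
  -- and equals it; otherwise `μ` itself is singular.
  obtain ⟨c, hc⟩ := hμ.eq_smul_of_absolutelyContinuous
    (hμ.toMeasurePreserving.singularPart hν.toMeasurePreserving)
    (Measure.absolutelyContinuous_of_le (μ.singularPart_le ν))
  by_cases h0 : c = 0
  · rw [h0, zero_smul, Measure.singularPart_eq_zero] at hc
    exact absurd (hν.eq_of_absolutelyContinuous hμ.toMeasurePreserving hc) h
  · have hs := μ.mutuallySingular_singularPart ν
    rw [hc] at hs
    refine hs.mono_ac (Measure.absolutelyContinuous_smul h0) Measure.AbsolutelyContinuous.rfl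

/-- The one-sided Bernoulli shift is ergodic. -/
theorem ergodic_shift_infinitePi (p : Measure X) [IsProbabilityMeasure p] :
    Ergodic (fun (s : ℕ → X) n => s (n + 1)) (Measure.infinitePi fun _ : ℕ => p) := by
  have hmeas : Measurable fun (s : ℕ → X) (n : ℕ) => s (n + 1) := by fun_prop
  refine ⟨⟨hmeas, Measure.map_infinitePi_infinitePi_of_inj (P := fun _ : ℕ => p)
    (add_left_injective 1)⟩, ⟨fun A hA hinv => ?_⟩⟩
  -- An invariant set is its own preimage under all iterates, so it depends only on coordinates from
  -- `n` on, for every `n`. Kolmogorov's zero-one law then applies.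
  have hiter (n : ℕ) : (fun (s : ℕ → X) i => s (i + n)) ⁻¹' A = A := by
    induction n with
    | zero => rfl
    | succ n ih =>
      conv_rhs => rw [← ih, ← hinv]
      ext s
      simp only [Set.mem_preimage]
      have : (fun i => s (i + (n + 1))) = fun i => s (i + 1 + n) := by
        funext i
        congr 1
        ring
      rw [this]
  have hind : iIndepFun (fun (i : ℕ) (s : ℕ → X) => s i) (Measure.infinitePi fun _ : ℕ => p) :=
    iIndepFun_infinitePi (P := fun _ : ℕ => p) (X := fun _ x => x) fun _ => measurable_id
  have htail : MeasurableSet[limsup (fun i : ℕ => MeasurableSpace.comap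
      (fun s : ℕ → X => s i) m) atTop] A := by
    rw [limsup_eq_iInf_iSup_of_nat, MeasurableSpace.measurableSet_iInf]
    intro n
    rw [← hiter n]
    refine (@measurable_pi_lambda _ _ _ (_) _ _ fun i => ?_) hA
    refine Measurable.mono (comap_measurable fun s : ℕ → X => s (i + n)) ?_ le_rfl
    exact le_iSup₂_of_le (i + n) (Nat.le_add_left n i) le_rfl
  have h01 := measure_zero_or_one_of_measurableSet_limsup_atTop
    (fun i => (measurable_pi_apply i).comap_le) hind htail
  rw [eventuallyConst_set]
  rcases h01 with h | h
  · right
    exact measure_eq_zero_iff_ae_notMem.1 h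
  · left
    exact (prob_compl_eq_zero_iff hA).2 h

end Ergodic

/-! ### The harmonic measure as the law of a random binary series -/

section Factor

/-- The factorisation at `θ = 0` can be cancelled because `escapeChar 0 ≠ 0`. Thus the exit law has
total mass one. -/
theorem exitChar_zero : exitChar 0 = 1 := by
  have h := escapeChar_eq_mul 0
  rw [zero_div] at h
  exact (mul_eq_left₀ integral_fourier_primal.1).1 h.symm

/-- The function `exitChar` is the characteristic function of a probability measure on the
integers with a first moment. -/
theorem exists_exitPMF : ∃ q : PMF ℤ,
    ∫⁻ x : ℤ, ENNReal.ofReal |(x : ℝ)| ∂q.toMeasure ≠ ⊤ ∧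
    ∀ θ, ∫ x, phase θ x ∂q.toMeasure = exitChar θ := by
  obtain ⟨p, hp0, hpm, hp⟩ := exists_exitLaw
  have h1 : HasSum p 1 := by
    have := hp 0
    rw [exitChar_zero] at this
    simp only [phase, zero_mul, Complex.ofReal_zero, Complex.exp_zero, one_mul] at this
    exact Complex.hasSum_ofReal.1 (by rwa [Complex.ofReal_one])
  have h2 : HasSum (fun x => ENNReal.ofReal (p x)) 1 := by
    rw [ENNReal.summable.hasSum_iff, ← ENNReal.ofReal_tsum_of_nonneg hp0 h1.summable, h1.tsum_eq,
      ENNReal.ofReal_one]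
  obtain ⟨q, hqp⟩ : ∃ q : PMF ℤ, ∀ x, q x = ENNReal.ofReal (p x) := ⟨⟨_, h2⟩, fun _ => rfl⟩
  refine ⟨q, ?_, fun θ => ?_⟩
  · rw [lintegral_countable']
    simp only [PMF.toMeasure_apply_singleton _ _ (measurableSet_singleton _), hqp,
      ← ENNReal.ofReal_mul (abs_nonneg _)]
    rw [← ENNReal.ofReal_tsum_of_nonneg (fun x => mul_nonneg (abs_nonneg _) (hp0 x)) hpm]
    exact ENNReal.ofReal_ne_top
  · rw [PMF.integral_eq_tsum _ _ (Integrable.of_bound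
      (measurable_of_countable _).aestronglyMeasurable 1
      (Eventually.of_forall fun x => (norm_phase θ x).le)), ← (hp θ).tsum_eq]
    refine tsum_congr fun x => ?_
    rw [hqp, ENNReal.toReal_ofReal (hp0 x), Complex.real_smul, mul_comm]

/-- The point of the circle given by a binary expansion with integer digits. -/
noncomputable def digitSum (s : ℕ → ℤ) : UnitAddCircle :=
  ((∑' n, (s n : ℝ) / 2 ^ (n + 1) : ℝ) : UnitAddCircle)

theorem measurable_digitSum : Measurable digitSum := by
  refine AddCircle.measurable_mk'.comp ?_
  exact Measurable.tsum fun n => ((measurable_of_countable fun x : ℤ => (x : ℝ)).comp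
    (measurable_pi_apply n)).div_const _

/-- Doubling turns the leading term into the integer `s 0`, which vanishes on the circle. -/
theorem two_nsmul_digitSum (s : ℕ → ℤ) :
    (2 : ℕ) • digitSum s = digitSum fun n => s (n + 1) := by
  have e (n : ℕ) : ((s (n + 1) : ℤ) : ℝ) / 2 ^ (n + 1)
      = 2 * ((s (n + 1) : ℝ) / 2 ^ (n + 1 + 1)) := by
    rw [pow_succ (2 : ℝ) (n + 1)]
    field_simp
  simp only [digitSum]
  rw [← AddCircle.coe_nsmul]
  by_cases h : Summable fun n => (s n : ℝ) / 2 ^ (n + 1)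
  · rw [h.tsum_eq_zero_add]
    simp only [e]
    rw [tsum_mul_left, nsmul_add, AddCircle.coe_add]
    have : (((2 : ℕ) • ((s 0 : ℝ) / 2 ^ (0 + 1)) : ℝ) : UnitAddCircle) = 0 := by
      rw [AddCircle.coe_eq_zero_iff]
      refine ⟨s 0, ?_⟩
      simp
      ring
    rw [this, zero_add, nsmul_eq_mul, Nat.cast_ofNat]
  -- Divergence is not affected by the shift, and both sums then take the default value zero, so the
  -- identity has no exceptions.
  · have h' : ¬ Summable fun n => (s (n + 1) : ℝ) / 2 ^ (n + 1) := by
      simp only [e]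
      rw [summable_mul_left_iff two_ne_zero]
      exact fun h' => h ((summable_nat_add_iff 1).1 h')
    rw [tsum_eq_zero_of_not_summable h, tsum_eq_zero_of_not_summable h', nsmul_zero]

variable {q : PMF ℤ}

theorem ae_summable_digits (hq : ∫⁻ x : ℤ, ENNReal.ofReal |(x : ℝ)| ∂q.toMeasure ≠ ⊤) :
    ∀ᵐ s ∂(Measure.infinitePi fun _ : ℕ => q.toMeasure),
      Summable fun n => (s n : ℝ) / 2 ^ (n + 1) := by
  have hg : Measurable fun x : ℤ => ENNReal.ofReal |(x : ℝ)| := measurable_of_countable _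
  have hm (n : ℕ) : Measurable fun s : ℕ → ℤ =>
      ENNReal.ofReal |(s n : ℝ)| * (2⁻¹ : ENNReal) ^ (n + 1) :=
    (hg.comp (measurable_pi_apply n)).mul_const _
  have hint (n : ℕ) : ∫⁻ s, ENNReal.ofReal |((s n : ℤ) : ℝ)|
      ∂(Measure.infinitePi fun _ : ℕ => q.toMeasure)
      = ∫⁻ x : ℤ, ENNReal.ofReal |(x : ℝ)| ∂q.toMeasure :=
    (measurePreserving_eval_infinitePi (fun _ : ℕ => q.toMeasure) n).lintegral_comp hg
  have h1 : ∫⁻ s, ∑' n, ENNReal.ofReal |((s n : ℤ) : ℝ)| * (2⁻¹ : ENNReal) ^ (n + 1)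
      ∂(Measure.infinitePi fun _ : ℕ => q.toMeasure) ≠ ⊤ := by
    rw [lintegral_tsum fun n => (hm n).aemeasurable]
    have (n : ℕ) : ∫⁻ s, ENNReal.ofReal |((s n : ℤ) : ℝ)| * (2⁻¹ : ENNReal) ^ (n + 1)
        ∂(Measure.infinitePi fun _ : ℕ => q.toMeasure)
        = (∫⁻ x : ℤ, ENNReal.ofReal |(x : ℝ)| ∂q.toMeasure) * (2⁻¹ : ENNReal) ^ (n + 1) := by
      rw [lintegral_mul_const' _ _ (by finiteness), hint]
    simp only [this]
    rw [ENNReal.tsum_mul_left, ENNReal.tsum_geometric_add_one, ENNReal.one_sub_inv_two]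
    exact ENNReal.mul_ne_top hq (by finiteness)
  filter_upwards [ae_lt_top (Measurable.tsum hm) h1] with s hs
  have := ENNReal.summable_toReal hs.ne
  refine Summable.of_norm (this.congr fun n => ?_)
  rw [ENNReal.toReal_mul, ENNReal.toReal_ofReal (abs_nonneg _), norm_div, Real.norm_eq_abs]
  simp [div_eq_mul_inv]

theorem prod_exitChar (θ : ℝ) (N : ℕ) :
    escapeChar θ = escapeChar (θ / 2 ^ N) * ∏ n ∈ Finset.range N, exitChar (θ / 2 ^ n) := by
  induction N with
  | zero => simp
  | succ N ih =>
    rw [ih, escapeChar_eq_mul (θ / 2 ^ N), Finset.prod_range_succ, div_div, ← pow_succ]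
    ring

theorem tendsto_escapeChar (θ : ℝ) :
    Tendsto (fun N : ℕ => escapeChar (θ / 2 ^ N)) atTop (𝓝 (escapeChar 0)) := by
  rw [tendsto_iff_norm_sub_tendsto_zero]
  refine squeeze_zero (fun _ => norm_nonneg _) (fun N => norm_escapeChar_sub_le _) ?_
  have h : Tendsto (fun N : ℕ => θ * (1 / 2) ^ N) atTop (𝓝 (θ * 0)) :=
    (tendsto_pow_atTop_nhds_zero_of_lt_one (by norm_num) (by norm_num)).const_mul θ
  have h2 := (h.abs).const_mul 20000
  rw [mul_zero, abs_zero, mul_zero] at h2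
  refine h2.congr fun N => ?_
  rw [one_div_pow, mul_one_div]

/-- Independence turns the coefficient of a partial sum into a product of values of `exitChar`,
which telescopes to `escapeChar (π * k) / escapeChar (π * k / 2 ^ N)` as soon as the denominator is
nonzero, hence for large `N`. -/
theorem integral_fourier_digitSum (hq : ∫⁻ x : ℤ, ENNReal.ofReal |(x : ℝ)| ∂q.toMeasure ≠ ⊤)
    (hchar : ∀ θ, ∫ x, phase θ x ∂q.toMeasure = exitChar θ) (k : ℤ) :
    ∫ z, fourier k z ∂(Measure.infinitePi fun _ : ℕ => q.toMeasure).map digitSum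
      = escapeChar (Real.pi * k) / escapeChar 0 := by
  set μ := Measure.infinitePi fun _ : ℕ => q.toMeasure with hμ
  set S : ℕ → (ℕ → ℤ) → UnitAddCircle := fun N s =>
    ((∑ n ∈ Finset.range N, (s n : ℝ) / 2 ^ (n + 1) : ℝ) : UnitAddCircle) with hS
  have hind : iIndepFun (fun (i : ℕ) (s : ℕ → ℤ) => s i) μ :=
    iIndepFun_infinitePi (P := fun _ : ℕ => q.toMeasure) (X := fun _ x => x)
      fun _ => measurable_id
  have hfS (N : ℕ) (s : ℕ → ℤ) :
      fourier k (S N s) = ∏ n : Fin N, phase (Real.pi * k / 2 ^ (n : ℕ)) (s n) := by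
    rw [Fin.prod_univ_eq_prod_range (fun n => phase (Real.pi * k / 2 ^ n) (s n)) N]
    simp only [hS, phase]
    rw [fourier_coe_apply, ← Complex.exp_sum]
    congr 1
    push_cast
    rw [Finset.mul_sum, Finset.sum_div]
    refine Finset.sum_congr rfl fun n _ => ?_
    rw [pow_succ]
    field_simp
  have hphase (θ : ℝ) : Measurable (phase θ) := measurable_of_countable _
  have hE (N : ℕ) : ∫ s, fourier k (S N s) ∂μ
      = ∏ n ∈ Finset.range N, exitChar (Real.pi * k / 2 ^ n) := by
    simp only [hfS]
    have := (hind.precomp (Fin.val_injective (n := N))).integral_fun_prod_comp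
      (f := fun n : Fin N => phase (Real.pi * k / 2 ^ (n : ℕ)))
      (fun n => (measurable_pi_apply _).aemeasurable) (fun n => (hphase _).aestronglyMeasurable)
    rw [this, ← Fin.prod_univ_eq_prod_range (fun n => exitChar (Real.pi * k / 2 ^ n)) N]
    refine Finset.prod_congr rfl fun n _ => ?_
    rw [← hchar]
    have h := integral_map (μ := μ) (measurable_pi_apply (n : ℕ)).aemeasurable
      (hphase (Real.pi * k / 2 ^ (n : ℕ))).aestronglyMeasurable
    rw [(measurePreserving_eval_infinitePi (fun _ : ℕ => q.toMeasure) (n : ℕ)).map_eq] at h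
    exact h.symm
  have hlim : Tendsto (fun N => ∫ s, fourier k (S N s) ∂μ) atTop
      (𝓝 (∫ s, fourier k (digitSum s) ∂μ)) := by
    refine tendsto_integral_of_dominated_convergence (fun _ => 1) (fun N => ?_)
      (integrable_const 1) (fun N => Eventually.of_forall fun s => (Circle.norm_coe _).le) ?_
    · simp only [hfS]
      exact (Finset.measurable_fun_prod _ fun n _ =>
        (hphase _).comp (measurable_pi_apply _)).aestronglyMeasurable
    · filter_upwards [ae_summable_digits hq] with s hs
      refine ((fourier k).continuous.tendsto _).comp ?_
      exact ((AddCircle.continuous_mk' (1 : ℝ)).tendsto _).comp hs.hasSum.tendsto_sum_nat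
  rw [integral_map measurable_digitSum.aemeasurable
    (fourier k).continuous.measurable.aestronglyMeasurable]
  refine tendsto_nhds_unique hlim ?_
  have h0 := integral_fourier_primal.1
  have hne : ∀ᶠ N : ℕ in atTop, escapeChar (Real.pi * k / 2 ^ N) ≠ 0 :=
    (tendsto_escapeChar (Real.pi * k)).eventually_ne h0
  refine ((tendsto_const_nhds (x := escapeChar (Real.pi * k))).div
    (tendsto_escapeChar (Real.pi * k)) h0).congr' ?_
  filter_upwards [hne] with N hN
  rw [hE, Pi.div_apply]
  conv_lhs => rw [prod_exitChar (Real.pi * k) N]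
  field_simp

end Factor

/-! ### Assembling the theorem -/

section Main

instance : IsProbabilityMeasure primalWalk := by
  unfold primalWalk
  infer_instance

instance : IsProbabilityMeasure dualWalk := by
  unfold dualWalk
  infer_instance

theorem map_limitPosition (μ : Measure (ℕ → BitString)) :
    μ.map limitPosition = (μ.map circleLimit).map circleRep := by
  rw [Measure.map_map measurable_circleRep measurable_circleLimit]
  rfl

theorem isProbabilityMeasure_map_limitPosition (μ : Measure (ℕ → BitString))
    [IsProbabilityMeasure μ] : IsProbabilityMeasure (μ.map limitPosition) :=
  Measure.isProbabilityMeasure_map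
    (measurable_circleRep.comp measurable_circleLimit : Measurable limitPosition).aemeasurable

theorem map_limitPosition_compl_Ico (μ : Measure (ℕ → BitString)) :
    μ.map limitPosition (Set.Ico 0 1)ᶜ = 0 := by
  rw [map_limitPosition, Measure.map_apply measurable_circleRep measurableSet_Ico.compl]
  have : circleRep ⁻¹' (Set.Ico 0 1)ᶜ = ∅ := by
    ext z
    simpa using circleRep_mem z
  rw [this, measure_empty]

theorem dualHarmonicMeasure_eq : dualHarmonicMeasure = volume.restrict (Set.Ico (0 : ℝ) 1) := by
  have : IsProbabilityMeasure (dualWalk.map circleLimit) :=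
    Measure.isProbabilityMeasure_map measurable_circleLimit.aemeasurable
  rw [dualHarmonicMeasure, map_limitPosition, ← map_circleRep_volume]
  congr 1
  refine circleMeasure_ext fun k => ?_
  by_cases hk : k = 0
  · subst hk
    simp
  · rw [integral_fourier_dual hk, integral_fourier_volume hk]

/-- It is nonzero near zero by continuity, and finitely many nonvanishing factors `exitChar` lead
from there to any `θ`. -/
theorem escapeChar_ne_zero (θ : ℝ) : escapeChar θ ≠ 0 := by
  obtain ⟨N, hN⟩ := ((tendsto_escapeChar θ).eventually_ne integral_fourier_primal.1).exists
  rw [prod_exitChar θ N]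
  exact mul_ne_zero hN (Finset.prod_ne_zero_iff.2 fun n _ => exitChar_ne_zero _)

theorem harmonicMeasure_ne_volume :
    harmonicMeasure ≠ volume.restrict (Set.Ico (0 : ℝ) 1) := by
  intro h
  rw [harmonicMeasure, map_limitPosition, ← map_circleRep_volume] at h
  have h1 := integral_fourier_primal.2 1
  rw [map_circleRep_eq_imp h, integral_fourier_volume one_ne_zero] at h1
  exact div_ne_zero (escapeChar_ne_zero _) (escapeChar_ne_zero _) h1.symm

theorem exists_harmonicMeasure_eq_map : ∃ q : PMF ℤ,
    (Measure.infinitePi fun _ : ℕ => q.toMeasure).map (fun s => circleRep (digitSum s))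
      = harmonicMeasure := by
  obtain ⟨q, hq, hchar⟩ := exists_exitPMF
  refine ⟨q, ?_⟩
  have : IsProbabilityMeasure (primalWalk.map circleLimit) :=
    Measure.isProbabilityMeasure_map measurable_circleLimit.aemeasurable
  have : IsProbabilityMeasure ((Measure.infinitePi fun _ : ℕ => q.toMeasure).map digitSum) :=
    Measure.isProbabilityMeasure_map measurable_digitSum.aemeasurable
  change Measure.map (circleRep ∘ digitSum) _ = _
  rw [harmonicMeasure, map_limitPosition, ← Measure.map_map measurable_circleRep
    measurable_digitSum]
  congr 1
  refine circleMeasure_ext fun k => ?_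
  rw [integral_fourier_digitSum hq hchar, integral_fourier_primal.2]

theorem circleRep_digitSum_shift (s : ℕ → ℤ) :
    circleRep (digitSum fun n => s (n + 1)) = digitShift (circleRep (digitSum s)) := by
  rw [digitShift_circleRep, two_nsmul_digitSum]

theorem isFactorOfIID_harmonicMeasure : IsFactorOfIID digitShift harmonicMeasure := by
  obtain ⟨q, hq⟩ := exists_harmonicMeasure_eq_map
  exact ⟨ℤ, inferInstance, inferInstance, q.toMeasure, inferInstance,
    fun s => circleRep (digitSum s), measurable_circleRep.comp measurable_digitSum,
    Eventually.of_forall circleRep_digitSum_shift, hq⟩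

theorem ergodic_harmonicMeasure : Ergodic digitShift harmonicMeasure := by
  obtain ⟨q, hq⟩ := exists_harmonicMeasure_eq_map
  have hm : MeasurePreserving (fun s => circleRep (digitSum s))
      (Measure.infinitePi fun _ : ℕ => q.toMeasure) harmonicMeasure :=
    ⟨measurable_circleRep.comp measurable_digitSum, hq⟩
  exact hm.ergodic_of_ergodic_semiconj (ergodic_shift_infinitePi _) measurable_digitShift
    circleRep_digitSum_shift

theorem harmonicMeasure_mutuallySingular_volume :
    harmonicMeasure ⟂ₘ volume.restrict (Set.Ico (0 : ℝ) 1) := by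
  have h1 : IsProbabilityMeasure harmonicMeasure := isProbabilityMeasure_map_limitPosition _
  have h2 : IsProbabilityMeasure (volume.restrict (Set.Ico (0 : ℝ) 1)) := by
    rw [← dualHarmonicMeasure_eq]
    exact isProbabilityMeasure_map_limitPosition _
  exact ergodic_harmonicMeasure.mutuallySingular ergodic_digitShift_volume
    harmonicMeasure_ne_volume

end Main

theorem mainTheorem3 :
    -- the horizontal positions of both walks converge almost surely in `ℝ / ℤ`
    (∀ᵐ X ∂primalWalk, ∃ z : UnitAddCircle,
      Tendsto (fun t => circlePosition (X t)) atTop (𝓝 z)) ∧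
    (∀ᵐ X ∂dualWalk, ∃ z : UnitAddCircle,
      Tendsto (fun t => circlePosition (X t)) atTop (𝓝 z)) ∧
    -- both harmonic measures are probability measures, carried by `[0, 1)`
    (IsProbabilityMeasure harmonicMeasure ∧ harmonicMeasure (Set.Ico 0 1)ᶜ = 0) ∧
    (IsProbabilityMeasure dualHarmonicMeasure ∧ dualHarmonicMeasure (Set.Ico 0 1)ᶜ = 0) ∧
    -- the harmonic measure and the dual harmonic measure are mutually singular
    harmonicMeasure ⟂ₘ dualHarmonicMeasure ∧
    -- the dual harmonic measure is Lebesgue measure on `[0, 1)`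
    dualHarmonicMeasure = volume.restrict (Set.Ico (0 : ℝ) 1) ∧
    -- the harmonic measure is singular with respect to Lebesgue measure, and distinct from it
    harmonicMeasure ⟂ₘ volume.restrict (Set.Ico (0 : ℝ) 1) ∧
    harmonicMeasure ≠ volume.restrict (Set.Ico (0 : ℝ) 1) ∧
    -- the harmonic measure is a shift-invariant factor of an i.i.d. sequence, and is ergodic
    IsFactorOfIID digitShift harmonicMeasure ∧
    Ergodic digitShift harmonicMeasure := by
  refine ⟨primal_isLyapunov.ae_exists_tendsto, dual_isLyapunov.ae_exists_tendsto,
    ⟨isProbabilityMeasure_map_limitPosition _, map_limitPosition_compl_Ico _⟩,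
    ⟨isProbabilityMeasure_map_limitPosition _, map_limitPosition_compl_Ico _⟩, ?_,
    dualHarmonicMeasure_eq, harmonicMeasure_mutuallySingular_volume, harmonicMeasure_ne_volume,
    isFactorOfIID_harmonicMeasure, ergodic_harmonicMeasure⟩
  rw [dualHarmonicMeasure_eq]
  exact harmonicMeasure_mutuallySingular_volume
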